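/- **Theorem.** There is a fully polynomial-time approximation scheme (FPTAS) for the following robust optimization problem. An instance consists of a finite ground set $E$, a positive integer $n$, nonnegative rational weights $w_{ke}$ ($k\in[n]=\{1,\dots,n\}$, $e\in E$) defining the monotone linear functions $f_k(X)=\sum_{e\in X}w_{ke}$ ($X\subseteq E$), nonnegative rational item sizes $s(e)$ ($e\in E$) and a nonnegative rational capacity $C$ defining the family of knapsack solutions $\mathcal I=\{X\subseteq E\mid \sum_{e\in X}s(e)\le C\}$, where $\max_{X\in\mathcal I}f_k(X)>0$ for every $k\in[n]$. With $\Delta(\mathcal I)$ the set of probability distributions on $\mathcal I$, the problem is $$\max_{p\in\Delta(\mathcal I)}\ \min_{k\in[n]}\ \sum_{X\in\mathcal I}p_X\, f_k(X).$$ Precisely: there are a single deterministic algorithm (a random access machine program under logarithmic, i.e. bit, cost) and a polynomial bound in two quantities such that for every instance and every real $\epsilon>0$ the algorithm, given the binary encoding of the instance and the integer $\lceil 1/\epsilon\rceil$, halts in time polynomial in the bit length of the instance and $1/\epsilon$, and outputs a distribution $p^*\in\Delta(\mathcal I)$, as an explicit list of sets with rational probabilities, such that $$\min_{k\in[n]}\sum_{X\in\mathcal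 I}p^*_X f_k(X)\ \ge\ (1-\epsilon)\,\max_{p\in\Delta(\mathcal I)}\min_{k\in[n]}\sum_{X\in\mathcal I}p_X f_k(X).$$ -/

import Mathlib

/-! ### Machine model: a random access machine with logarithmic (bit) cost

Memory consists of cells holding natural numbers. A cell is named by a bank (a constant that is
fixed in the program text, so a program uses finitely many banks) and by an index (which may be
computed at run time). Every operation is charged the bit lengths of all numbers it touches,
addresses included. -/

namespace Ram

/-- A memory: `σ b i` is the content of cell `i` of bank `b`. -/
abbrev Mem : Type := ℕ → ℕ → ℕ

/-- The primitive arithmetic operations on natural numbers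
(truncated subtraction, and integer quotient with `x / 0 = 0`). -/
inductive Op : Type
  | add
  | sub
  | mul
  | div

/-- The value of a primitive operation. -/
def Op.eval : Op → ℕ → ℕ → ℕ
  | .add, x, y => x + y
  | .sub, x, y => x - y
  | .mul, x, y => x * y
  | .div, x, y => x / y

/-- Expressions: constants, contents of memory cells, and primitive operations. -/
inductive Expr : Type
  | lit (x : ℕ)
  | load (bank : ℕ) (index : Expr)
  | op (o : Op) (a b : Expr)

/-- The value of an expression in a memory. -/
def Expr.eval (σ : Mem) : Expr → ℕ
  | .lit x => x
  | .load b i => σ b (i.eval σ)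
  | .op o a b => o.eval (a.eval σ) (b.eval σ)

/-- The cost of evaluating an expression: one unit per node, plus the bit lengths
(`Nat.size`) of the constants, of the addresses and contents read, and of the operands. -/
def Expr.cost (σ : Mem) : Expr → ℕ
  | .lit x => 1 + Nat.size x
  | .load b i => i.cost σ + 1 + Nat.size (i.eval σ) + Nat.size (σ b (i.eval σ))
  | .op _ a b => a.cost σ + b.cost σ + 1 + Nat.size (a.eval σ) + Nat.size (b.eval σ)

/-- Programs. A condition counts as true when its value is not `0`. -/
inductive Prog : Type
  | skip
  | store (bank : ℕ) (index value : Expr)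
  | seq (p q : Prog)
  | ite (cond : Expr) (p q : Prog)
  | loop (cond : Expr) (body : Prog)

/-- The memory `σ` after writing `x` into cell `i` of bank `b`. -/
def Mem.write (σ : Mem) (b i x : ℕ) : Mem :=
  Function.update σ b (Function.update (σ b) i x)

/-- `Exec p σ t τ`: the program `p`, started in memory `σ`, halts in memory `τ`
after a run of total cost exactly `t`. -/
inductive Exec : Prog → Mem → ℕ → Mem → Prop
  | skip (σ : Mem) : Exec .skip σ 1 σ
  | store (σ : Mem) (b : ℕ) (i v : Expr) :
      Exec (.store b i v) σ
        (i.cost σ + v.cost σ + 1 + Nat.size (i.eval σ) + Nat.size (v.eval σ))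
        (σ.write b (i.eval σ) (v.eval σ))
  | seq {p q : Prog} {σ τ ρ : Mem} {t u : ℕ} :
      Exec p σ t τ → Exec q τ u ρ → Exec (.seq p q) σ (t + u) ρ
  | ite_true {c : Expr} {p q : Prog} {σ τ : Mem} {t : ℕ} :
      c.eval σ ≠ 0 → Exec p σ t τ → Exec (.ite c p q) σ (c.cost σ + 1 + t) τ
  | ite_false {c : Expr} {p q : Prog} {σ τ : Mem} {t : ℕ} :
      c.eval σ = 0 → Exec q σ t τ → Exec (.ite c p q) σ (c.cost σ + 1 + t) τ
  | loop_done {c : Expr} {p : Prog} {σ : Mem} :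
      c.eval σ = 0 → Exec (.loop c p) σ (c.cost σ + 1) σ
  | loop_step {c : Expr} {p : Prog} {σ τ ρ : Mem} {t u : ℕ} :
      c.eval σ ≠ 0 → Exec p σ t τ → Exec (.loop c p) τ u ρ →
        Exec (.loop c p) σ (c.cost σ + 1 + t + u) ρ

/-- The machine is deterministic: cost and final memory of a run are unique. -/
theorem Exec.det {p : Prog} {σ τ τ' : Mem} {t t' : ℕ}
    (h : Exec p σ t τ) (h' : Exec p σ t' τ') : t = t' ∧ τ = τ' := by
  induction h generalizing t' τ' with
  | skip σ => cases h'; exact ⟨rfl, rfl⟩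
  | store σ b i v => cases h'; exact ⟨rfl, rfl⟩
  | seq _ _ ih1 ih2 =>
    cases h' with
    | seq g1 g2 =>
      obtain ⟨rfl, rfl⟩ := ih1 g1
      obtain ⟨rfl, rfl⟩ := ih2 g2
      exact ⟨rfl, rfl⟩
  | ite_true hc _ ih =>
    cases h' with
    | ite_true _ g => obtain ⟨rfl, rfl⟩ := ih g; exact ⟨rfl, rfl⟩
    | ite_false gc _ => exact absurd gc hc
  | ite_false hc _ ih =>
    cases h' with
    | ite_true gc _ => exact absurd hc gc
    | ite_false _ g => obtain ⟨rfl, rfl⟩ := ih g; exact ⟨rfl, rfl⟩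
  | loop_done hc =>
    cases h' with
    | loop_done _ => exact ⟨rfl, rfl⟩
    | loop_step gc _ _ => exact absurd hc gc
  | loop_step hc _ _ ih1 ih2 =>
    cases h' with
    | loop_done gc => exact absurd gc hc
    | loop_step _ g1 g2 =>
      obtain ⟨rfl, rfl⟩ := ih1 g1
      obtain ⟨rfl, rfl⟩ := ih2 g2
      exact ⟨rfl, rfl⟩

/-- The initial memory: the input list occupies bank `0`, every other cell holds `0`. -/
def initMem (input : List ℕ) : Mem :=
  fun b i => if b = 0 then input.getD i 0 else 0

/-- The bit length of a list of natural numbers, with one separator per entry. -/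
def bitSize (l : List ℕ) : ℕ := (l.map fun x => Nat.size x + 1).sum

end Ram

/-! ### The robust knapsack problem with monotone linear objectives -/

/-- An instance: `n ≥ 1` scenarios, the ground set `E = Fin m`, nonnegative rational weights
`w k e` of the linear objectives, item sizes `s e`, and the capacity `C`. -/
structure RobustKnapsack where
  n : ℕ
  m : ℕ
  n_pos : 0 < n
  w : Fin n → Fin m → NNRat
  s : Fin m → NNRat
  C : NNRat

namespace RobustKnapsack

variable (I : RobustKnapsack)

/-- The family of knapsack solutions. -/
def feasible : Finset (Finset (Fin I.m)) :=
  Finset.univ.filter fun X => ∑ e ∈ X, I.s e ≤ I.C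

/-- The monotone linear objective function of scenario `k`. -/
noncomputable def f (k : Fin I.n) (X : Finset (Fin I.m)) : ℝ :=
  ∑ e ∈ X, (I.w k e : ℝ)

/-- `p` is a randomized strategy, that is, a probability distribution on the family of
knapsack solutions (extended by `0` to all subsets of the ground set). -/
def IsStrategy (p : Finset (Fin I.m) → ℝ) : Prop :=
  (∀ X, 0 ≤ p X) ∧ (∀ X, X ∉ I.feasible → p X = 0) ∧ ∑ X ∈ I.feasible, p X = 1

/-- The worst case value of a strategy: a minimum over the finite nonempty set of scenarios. -/
noncomputable def value (p : Finset (Fin I.m) → ℝ) : ℝ :=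
  ⨅ k : Fin I.n, ∑ X ∈ I.feasible, p X * I.f k X

/-- A nonnegative rational is written as its numerator followed by its denominator
(in lowest terms). -/
def encodeRat (q : NNRat) : List ℕ := [q.num, q.den]

/-- The input list of an instance: `n`, `m`, the capacity, the sizes of the items, and the
weights row by row (scenario by scenario). -/
def encode : List ℕ :=
  [I.n, I.m] ++ encodeRat I.C ++ (List.ofFn I.s).flatMap encodeRat
    ++ (List.ofFn fun k => (List.ofFn (I.w k)).flatMap encodeRat).flatten

/-- The size of an instance: the bit length of its binary encoding. -/
def size : ℕ := Ram.bitSize I.encode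

/-- The set that is described by record number `t` of the output `out`, see `decode`. -/
def outSet (out : ℕ → ℕ) (t : ℕ) : Finset (Fin I.m) :=
  Finset.univ.filter fun e => out (3 + t * (I.m + 2) + e) ≠ 0

/-- The randomized strategy that an output describes. Cell `0` holds the number `T` of records.
Record `t < T` starts in cell `1 + t * (m + 2)` and consists of the numerator and the denominator
of a probability, followed by the `m` indicator entries of a set. The probability of `X` is the
total of the probabilities in the records whose set is `X`. -/
noncomputable def decode (out : ℕ → ℕ) (X : Finset (Fin I.m)) : ℝ :=
  ∑ t ∈ Finset.range (out 0),
    if I.outSet out t = X then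
      (out (1 + t * (I.m + 2)) : ℝ) / (out (2 + t * (I.m + 2)) : ℝ)
    else 0

end RobustKnapsack

/-! The problem is a zero-sum game between a player choosing a knapsack set and an adversary
choosing a scenario, and it is solved approximately by repeated play. Scenario `k` carries an
integer weight `y k ≥ 1`. In each round the player takes a set `X` maximizing the `y`-weighted sum
of the rounded scenario values, `v` is the floor of the weighted average attained, and `y k` becomes
the maximum of `1` and `y k + v - val k X`. The weighted sum of the differences `v - val k X` is at
most zero, so the cross term in the sum of the squares `y k ^ 2` does not help the adversary, and
this sum grows only linearly with the rounds (`sum_upd_sq_le`). Hence `y k` is of order the square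
root of the number of rounds. Conversely, `y k` plus the value collected in scenario `k` is at least
`t * g` after `t` rounds whenever best responses always reach average `g` (`Progress.succ`). For `T`
large enough the uniform distribution on the played sets therefore achieves at least `g - 1` in
every scenario. That best responses reach nearly the optimum is the easy half of minimax: some set
does at least as well as the average over an optimal strategy (`attainable_of_mix`).

A best response is an ordinary knapsack problem, solved exactly by a dynamic program over profits
(`exists_opt`), which needs polynomially bounded profits. Let `L` be the minimum over the scenarios
of the largest weight of an item that fits; the optimum lies between `L / m` and `m * L`. Weights
are scaled by `K / L`, rounded down and truncated at `B`. Rounding costs less than one unit per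
item. Truncation matters only when a scenario has a huge fitting item, and it is paid for by mixing
in, with probability `1 / (2 * N)`, the uniform choice of a single item (`attainable_of_strategy`).
`Nondegenerate.approx` collects the losses into the factor `1 - 1 / N`.

For the running time, `Runs` is a total-correctness calculus with two resources: a bit width `β` for
all cells and a bound `Q` on the rounds of each loop. Cost is polynomial in `β` and `Q` with a
degree fixed by the program (`Prog.bound_le`), and `fits` makes both polynomial in the input size
and `N`. -/

namespace Ram

/-! ### Expressions and cost bounds in terms of bit width and loop rounds. -/

instance : Add Expr := ⟨.op .add⟩
instance : Sub Expr := ⟨.op .sub⟩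
instance : Mul Expr := ⟨.op .mul⟩
instance : Div Expr := ⟨.op .div⟩
instance (x : ℕ) : OfNat Expr x := ⟨.lit x⟩

/-- The expression reading cell `i` of bank `b`. -/
def rd (b : ℕ) (i : Expr) : Expr := .load b i

/-- The scalar variable held in cell `0` of bank `b`. -/
def var (b : ℕ) : Expr := .load b (.lit 0)

@[simp] theorem eval_add (σ : Mem) (a b : Expr) : (a + b).eval σ = a.eval σ + b.eval σ := rfl
@[simp] theorem eval_sub (σ : Mem) (a b : Expr) : (a - b).eval σ = a.eval σ - b.eval σ := rfl
@[simp] theorem eval_mul (σ : Mem) (a b : Expr) : (a * b).eval σ = a.eval σ * b.eval σ := rfl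
@[simp] theorem eval_div (σ : Mem) (a b : Expr) : (a / b).eval σ = a.eval σ / b.eval σ := rfl
@[simp] theorem eval_ofNat (σ : Mem) (x : ℕ) : (ofNat(x) : Expr).eval σ = OfNat.ofNat x := rfl
@[simp] theorem eval_zero (σ : Mem) : (0 : Expr).eval σ = 0 := rfl
@[simp] theorem eval_one (σ : Mem) : (1 : Expr).eval σ = 1 := rfl
@[simp] theorem eval_rd (σ : Mem) (b : ℕ) (i : Expr) : (rd b i).eval σ = σ b (i.eval σ) := rfl
@[simp] theorem eval_var (σ : Mem) (b : ℕ) : (var b).eval σ = σ b 0 := rfl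

/-- Every cell of `σ` holds a number of at most `β` bits. -/
def Bounded (β : ℕ) (σ : Mem) : Prop := ∀ b i, σ b i < 2 ^ β

/-- A bound for the bit length of the value of an expression, per bit of the memory cells. -/
def Expr.sizeCoef : Expr → ℕ
  | .lit x => Nat.size x
  | .load _ _ => 1
  | .op _ a b => a.sizeCoef + b.sizeCoef + 1

/-- A bound for the cost of an expression, per bit of the memory cells. -/
def Expr.costCoef : Expr → ℕ
  | .lit x => 1 + Nat.size x
  | .load _ i => i.costCoef + 1 + i.sizeCoef + 1
  | .op _ a b => a.costCoef + b.costCoef + 1 + a.sizeCoef + b.sizeCoef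

theorem Op.size_eval_le (o : Op) (x y : ℕ) :
    Nat.size (o.eval x y) ≤ Nat.size x + Nat.size y + 1 := by
  have hx := Nat.lt_size_self x
  have hy := Nat.lt_size_self y
  cases o with
  | add =>
    rw [Nat.size_le]
    have h1 : (2 : ℕ) ^ Nat.size x ≤ 2 ^ (Nat.size x + Nat.size y) :=
      Nat.pow_le_pow_right (by norm_num) (by omega)
    have h2 : (2 : ℕ) ^ Nat.size y ≤ 2 ^ (Nat.size x + Nat.size y) :=
      Nat.pow_le_pow_right (by norm_num) (by omega)
    simp only [Op.eval, pow_succ]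
    omega
  | sub => exact (Nat.size_le_size (Nat.sub_le x y)).trans (by omega)
  | mul =>
    refine (Nat.size_le.2 ?_).trans (Nat.le_succ _)
    rw [pow_add]
    exact Nat.mul_lt_mul'' hx hy
  | div => exact (Nat.size_le_size (Nat.div_le_self x y)).trans (by omega)

theorem Expr.size_eval_le {β : ℕ} {σ : Mem} (h : Bounded β σ) :
    ∀ e : Expr, Nat.size (e.eval σ) ≤ e.sizeCoef * (β + 1)
  | .lit x => Nat.le_mul_of_pos_right _ (Nat.succ_pos β)
  | .load b i => by
    have := Nat.size_le.2 (h b (i.eval σ))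
    simp only [eval, sizeCoef]
    omega
  | .op o a b => by
    have h1 := size_eval_le h a
    have h2 := size_eval_le h b
    have h3 := o.size_eval_le (a.eval σ) (b.eval σ)
    simp only [eval, sizeCoef, add_mul]
    omega

theorem Expr.cost_le {β : ℕ} {σ : Mem} (h : Bounded β σ) :
    ∀ e : Expr, e.cost σ ≤ e.costCoef * (β + 1)
  | .lit x => Nat.le_mul_of_pos_right _ (Nat.succ_pos β)
  | .load b i => by
    have h1 := cost_le h i
    have h2 := size_eval_le h i
    have h3 := Nat.size_le.2 (h b (i.eval σ))
    simp only [cost, costCoef, add_mul]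
    omega
  | .op o a b => by
    have h1 := cost_le h a
    have h2 := cost_le h b
    have h3 := size_eval_le h a
    have h4 := size_eval_le h b
    simp only [cost, costCoef, add_mul]
    omega

/-- The banks that occur as targets of the store instructions of a program. -/
def Prog.banks : Prog → List ℕ
  | .skip => []
  | .store b _ _ => [b]
  | .seq p q => p.banks ++ q.banks
  | .ite _ p q => p.banks ++ q.banks
  | .loop _ p => p.banks

/-- A bound for the cost of a run in which all cells have at most `β` bits and every loop makes at
most `Q` rounds each time it is entered. -/
def Prog.bound (β Q : ℕ) : Prog → ℕ
  | .skip => 1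
  | .store _ i v =>
    (i.costCoef + v.costCoef + 1 + i.sizeCoef + v.sizeCoef) * (β + 1)
  | .seq p q => p.bound β Q + q.bound β Q
  | .ite c p q => (c.costCoef + 1) * (β + 1) + p.bound β Q + q.bound β Q
  | .loop c p => (Q + 1) * ((c.costCoef + 1) * (β + 1) + p.bound β Q)

/-- The nesting depth of the loops of a program. -/
def Prog.depth : Prog → ℕ
  | .skip => 0
  | .store _ _ _ => 0
  | .seq p q => p.depth + q.depth
  | .ite _ p q => p.depth + q.depth
  | .loop _ p => p.depth + 1

/-- `Prog.depth` adds along sequences and branches, so it overcounts nesting, but one power of `Q +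
1` then dominates both parts. Coefficient and exponent depend on the program text only, which is
what makes the final bound polynomial. -/
theorem Prog.bound_le (P : Prog) :
    ∃ C : ℕ, ∀ β Q : ℕ, P.bound β Q ≤ C * (β + 1) * (Q + 1) ^ P.depth := by
  have mono (C β Q d d' : ℕ) (h : d ≤ d') :
      C * (β + 1) * (Q + 1) ^ d ≤ C * (β + 1) * (Q + 1) ^ d' :=
    Nat.mul_le_mul_left _ (Nat.pow_le_pow_right (Nat.succ_pos Q) h)
  induction P with
  | skip => exact ⟨1, fun β Q => by simp [bound, depth]⟩
  | store b i v => exact ⟨_, fun β Q => by simp [bound, depth]; rfl⟩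
  | seq p q hp hq =>
    obtain ⟨C, hC⟩ := hp
    obtain ⟨C', hC'⟩ := hq
    refine ⟨C + C', fun β Q => ?_⟩
    have h1 := (hC β Q).trans (mono C β Q _ (p.depth + q.depth) (by omega))
    have h2 := (hC' β Q).trans (mono C' β Q _ (p.depth + q.depth) (by omega))
    simp only [bound, depth, add_mul] at *
    omega
  | ite c p q hp hq =>
    obtain ⟨C, hC⟩ := hp
    obtain ⟨C', hC'⟩ := hq
    refine ⟨(c.costCoef + 1) + C + C', fun β Q => ?_⟩
    have h0 := mono (c.costCoef + 1) β Q 0 (p.depth + q.depth) (by omega)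
    have h1 := (hC β Q).trans (mono C β Q _ (p.depth + q.depth) (by omega))
    have h2 := (hC' β Q).trans (mono C' β Q _ (p.depth + q.depth) (by omega))
    simp only [bound, depth, add_mul, pow_zero, mul_one] at *
    omega
  | loop c p hp =>
    obtain ⟨C, hC⟩ := hp
    refine ⟨(c.costCoef + 1) + C, fun β Q => ?_⟩
    have h0 := mono (c.costCoef + 1) β Q 0 p.depth (by omega)
    have h1 := hC β Q
    simp only [bound, depth, pow_succ]
    rw [pow_zero, mul_one] at h0
    calc (Q + 1) * ((c.costCoef + 1) * (β + 1) + p.bound β Q)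
        ≤ (Q + 1) * ((c.costCoef + 1) * (β + 1) * (Q + 1) ^ p.depth
            + C * (β + 1) * (Q + 1) ^ p.depth) := Nat.mul_le_mul_left _ (by omega)
      _ = _ := by ring

/-! ### A calculus of total correctness with frames and resource bounds. -/

theorem write_same (σ : Mem) (b i x : ℕ) : σ.write b i x b i = x := by
  simp [Mem.write]

theorem write_bank_ne (σ : Mem) {b b' : ℕ} (i x : ℕ) (h : b' ≠ b) : σ.write b i x b' = σ b' := by
  simp [Mem.write, h]

theorem write_index_ne (σ : Mem) (b : ℕ) {i j : ℕ} (x : ℕ) (h : j ≠ i) :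
    σ.write b i x b j = σ b j := by
  simp [Mem.write, h]

theorem Bounded.write {β : ℕ} {σ : Mem} (h : Bounded β σ) (b i : ℕ) {x : ℕ} (hx : x < 2 ^ β) :
    Bounded β (σ.write b i x) := by
  intro b' j
  by_cases hb : b' = b
  · subst hb
    by_cases hj : j = i
    · subst hj; rwa [write_same]
    · rw [write_index_ne σ _ x hj]; exact h _ _
  · rw [write_bank_ne σ i x hb]; exact h _ _

/-- `τ` differs from `σ` only in the banks of the list `l`. -/
def Agree (l : List ℕ) (σ τ : Mem) : Prop := ∀ b, b ∉ l → τ b = σ b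

/-- Started in `σ`, the program halts within the cost bound `Prog.bound β Q`, with all cells of at
most `β` bits, and `φ` holds for the final memory. -/
def Runs (β Q : ℕ) (P : Prog) (σ : Mem) (φ : Mem → Prop) : Prop :=
  Bounded β σ → ∃ t τ, Exec P σ t τ ∧ t ≤ P.bound β Q ∧ Bounded β τ ∧ Agree P.banks σ τ ∧ φ τ

variable {β Q : ℕ}

theorem Runs.mono {P : Prog} {σ : Mem} {φ ψ : Mem → Prop} (h : Runs β Q P σ φ)
    (hψ : ∀ τ, Agree P.banks σ τ → φ τ → ψ τ) : Runs β Q P σ ψ := by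
  intro hσ
  obtain ⟨t, τ, h1, h2, h3, h4, h5⟩ := h hσ
  exact ⟨t, τ, h1, h2, h3, h4, hψ τ h4 h5⟩

theorem Runs.store {σ : Mem} {b : ℕ} {i v : Expr} {φ : Mem → Prop} (hv : v.eval σ < 2 ^ β)
    (h : φ (σ.write b (i.eval σ) (v.eval σ))) : Runs β Q (.store b i v) σ φ := by
  intro hσ
  refine ⟨_, _, .store σ b i v, ?_, hσ.write _ _ hv, ?_, h⟩
  · have h1 := i.cost_le hσ
    have h2 := v.cost_le hσ
    have h3 := i.size_eval_le hσ
    have h4 := v.size_eval_le hσ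
    simp only [Prog.bound, add_mul]
    omega
  · intro b' hb
    exact write_bank_ne _ _ _ (by simpa [Prog.banks] using hb)

theorem Runs.seq {P P' : Prog} {σ : Mem} {φ ψ : Mem → Prop} (h : Runs β Q P σ φ)
    (h' : ∀ τ, Agree P.banks σ τ → φ τ → Runs β Q P' τ ψ) : Runs β Q (.seq P P') σ ψ := by
  intro hσ
  obtain ⟨t, τ, h1, h2, h3, h4, h5⟩ := h hσ
  obtain ⟨u, ρ, g1, g2, g3, g4, g5⟩ := h' τ h4 h5 h3
  refine ⟨_, _, .seq h1 g1, Nat.add_le_add h2 g2, g3, fun b hb => ?_, g5⟩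
  simp only [Prog.banks, List.mem_append, not_or] at hb
  rw [g4 b hb.2, h4 b hb.1]

/-- `for x < R do body`, where the counter `x` is a scalar variable. -/
def forLoop (x : ℕ) (R : Expr) (body : Prog) : Prog :=
  .seq (.store x 0 0) (.loop (R - var x) (.seq body (.store x 0 (var x + 1))))

/-- The limit `R` is re-evaluated at every test, so it has to be constant under changes of the
counter and of the banks of the body. `stable` lets the invariant survive the increment of the
counter, and `Q < 2 ^ β` keeps the counter within the bit width. -/
theorem Runs.forLoop {x : ℕ} {R : Expr} {body : Prog} {σ : Mem} (r : ℕ) (Inv : ℕ → Mem → Prop)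
    (hr : r ≤ Q) (hQ : Q < 2 ^ β) (hx : x ∉ body.banks)
    (hR : ∀ τ, Agree (x :: body.banks) σ τ → R.eval τ = r)
    (stable : ∀ i τ v, Inv i τ → Inv i (τ.write x 0 v))
    (init : Inv 0 σ)
    (step : ∀ i < r, ∀ τ, Agree (x :: body.banks) σ τ → τ x 0 = i → Inv i τ →
      Runs β Q body τ (Inv (i + 1))) :
    Runs β Q (Ram.forLoop x R body) σ (Inv r) := by
  set L : Prog := .loop (R - var x) (.seq body (.store x 0 (var x + 1)))
  have hwrite (τ : Mem) (v : ℕ) (h : Agree (x :: body.banks) σ τ) :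
      Agree (x :: body.banks) σ (τ.write x 0 v) := by
    intro b hb
    have hbx : b ≠ x := fun h => hb (by simp [h])
    rw [write_bank_ne _ _ _ hbx, h b hb]
  -- Induction on the number `j` of remaining rounds; the test is evaluated once more than the body.
  have main (j : ℕ) : ∀ i τ, i + j = r → Bounded β τ → Agree (x :: body.banks) σ τ → τ x 0 = i →
      Inv i τ → ∃ t ρ, Exec L τ t ρ ∧
        t ≤ (j + 1) * ((R - var x).costCoef + 1) * (β + 1) +
          j * (Prog.seq body (.store x 0 (var x + 1))).bound β Q ∧
        Bounded β ρ ∧ Agree (x :: body.banks) σ ρ ∧ Inv r ρ := by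
    induction j with
    | zero =>
      intro i τ hi hB hA hxi hI
      obtain rfl : i = r := by omega
      have hc : (R - var x).eval τ = 0 := by simp [hR τ hA, hxi]
      refine ⟨_, _, .loop_done hc, ?_, hB, hA, hI⟩
      have := (R - var x).cost_le hB
      simp only [zero_add, one_mul, zero_mul, add_zero, add_mul]
      omega
    | succ j ih =>
      intro i τ hi hB hA hxi hI
      have hc : (R - var x).eval τ ≠ 0 := by simp only [eval_sub, hR τ hA, eval_var, hxi]; omega
      have hbody : Runs β Q (.seq body (.store x 0 (var x + 1))) τ
          (fun ρ => ρ x 0 = i + 1 ∧ Inv (i + 1) ρ) := by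
        refine (step i (by omega) τ hA hxi hI).seq fun ρ hρ hIρ => ?_
        have hρx : ρ x 0 = i := by rw [hρ x hx, hxi]
        refine .store ?_ ⟨?_, stable _ _ _ hIρ⟩
        · simp only [eval_add, eval_var, hρx, eval_one]; omega
        · simp [write_same, hρx]
      obtain ⟨t, ρ, h1, h2, h3, h4, h5, h6⟩ := hbody hB
      have hAρ : Agree (x :: body.banks) σ ρ := by
        intro b hb
        rw [h4 b (by simpa [Prog.banks, or_comm] using hb), hA b hb]
      obtain ⟨u, υ, g1, g2, g3, g4, g5⟩ := ih (i + 1) ρ (by omega) h3 hAρ h5 h6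
      refine ⟨_, υ, .loop_step hc h1 g1, ?_, g3, g4, g5⟩
      have := (R - var x).cost_le hB
      generalize (Prog.seq body (.store x 0 (var x + 1))).bound β Q = B at *
      have e : (R - var x).cost τ + 1 ≤ ((R - var x).costCoef + 1) * (β + 1) := by
        rw [add_mul]; omega
      calc (R - var x).cost τ + 1 + t + u ≤ ((R - var x).costCoef + 1) * (β + 1) + B +
            ((j + 1) * ((R - var x).costCoef + 1) * (β + 1) + j * B) := by omega
        _ = _ := by ring
  intro hσ
  obtain ⟨t, ρ, h1, h2, h3, h4, h5⟩ := main r 0 (σ.write x 0 0) (by omega)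
    (hσ.write _ _ (by positivity)) (hwrite σ 0 fun _ _ => rfl) (write_same _ _ _ _)
    (stable _ _ _ init)
  refine ⟨_, ρ, .seq (.store σ x 0 0) h1, ?_, h3, ?_, h5⟩
  · have s0 : Exec (.store x 0 0) σ _ _ := .store σ x 0 0
    obtain ⟨s, _, s1, s2, -⟩ := Runs.store (β := β) (Q := Q) (σ := σ) (b := x) (i := 0) (v := 0)
      (φ := fun _ => True) (by simp) trivial hσ
    -- Determinism identifies the cost bounded by `Runs.store` with the cost of the given run.
    obtain ⟨rfl, -⟩ := s1.det s0
    rw [Ram.forLoop, Prog.bound]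
    refine Nat.add_le_add s2 (h2.trans ?_)
    rw [show ∀ c p, (Prog.loop c p).bound β Q =
      (Q + 1) * ((c.costCoef + 1) * (β + 1) + p.bound β Q) from fun _ _ => rfl,
      Nat.mul_add (Q + 1), ← Nat.mul_assoc (Q + 1)]
    gcongr
    omega
  · intro b hb
    refine h4 b fun h => hb ?_
    simp only [Ram.forLoop, Prog.banks, List.mem_append, List.mem_cons, List.not_mem_nil] at h ⊢
    tauto

/-- A loop that fills the cells `addr i`, `i < r`, of bank `b`. -/
theorem Runs.fill {x b : ℕ} {R idx v : Expr} {σ : Mem} (r : ℕ) (addr val : ℕ → ℕ)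
    (hr : r ≤ Q) (hQ : Q < 2 ^ β) (hxb : x ≠ b)
    (hR : ∀ τ, Agree [x, b] σ τ → R.eval τ = r)
    (hinj : ∀ i < r, ∀ j < i, addr j ≠ addr i)
    (hval : ∀ i < r, val i < 2 ^ β)
    (step : ∀ i < r, ∀ τ, Agree [x, b] σ τ → τ x 0 = i → (∀ j < i, τ b (addr j) = val j) →
      (∀ a, (∀ j < i, a ≠ addr j) → τ b a = σ b a) →
      idx.eval τ = addr i ∧ v.eval τ = val i) :
    Runs β Q (Ram.forLoop x R (.store b idx v)) σ fun τ =>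
      (∀ j < r, τ b (addr j) = val j) ∧ ∀ a, (∀ j < r, a ≠ addr j) → τ b a = σ b a := by
  refine Runs.forLoop r (fun i τ => (∀ j < i, τ b (addr j) = val j) ∧
    ∀ a, (∀ j < i, a ≠ addr j) → τ b a = σ b a) hr hQ (by simpa [Prog.banks] using hxb) hR ?_ ?_ ?_
  · intro i τ v h
    rwa [write_bank_ne _ _ _ hxb.symm]
  · simp
  · rintro i hi τ hA hx ⟨h1, h2⟩
    obtain ⟨e1, e2⟩ := step i hi τ hA hx h1 h2
    refine .store (by rw [e2]; exact hval i hi) ⟨fun j hj => ?_, fun a ha => ?_⟩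
    · rw [e1, e2]
      rcases Nat.lt_succ_iff_lt_or_eq.1 hj with hj | rfl
      · rw [write_index_ne _ _ _ (hinj i hi j hj), h1 j hj]
      · rw [write_same]
    · rw [e1, write_index_ne _ _ _ (ha i (Nat.lt_succ_self i)), h2 a fun j hj => ha j (by omega)]

/-- A loop that accumulates a value in the scalar variable `b`. -/
theorem Runs.fold {x b : ℕ} {R v : Expr} {σ : Mem} (r : ℕ) (acc : ℕ → ℕ)
    (hr : r ≤ Q) (hQ : Q < 2 ^ β) (hxb : x ≠ b)
    (hR : ∀ τ, Agree [x, b] σ τ → R.eval τ = r)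
    (hacc : ∀ i ≤ r, acc i < 2 ^ β) (init : σ b 0 = acc 0)
    (step : ∀ i < r, ∀ τ, Agree [x, b] σ τ → τ x 0 = i → τ b 0 = acc i →
      v.eval τ = acc (i + 1)) :
    Runs β Q (Ram.forLoop x R (.store b 0 v)) σ fun τ => τ b 0 = acc r := by
  refine Runs.forLoop r (fun i τ => τ b 0 = acc i) hr hQ (by simpa [Prog.banks] using hxb) hR
    ?_ init ?_
  · intro i τ v h
    rwa [write_bank_ne _ _ _ hxb.symm]
  · intro i hi τ hA hx h
    have e := step i hi τ hA hx h
    exact .store (by rw [e]; exact hacc _ hi) (by rw [eval_zero, write_same, e])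

end Ram

/-- Data of an integral robust knapsack instance with `n` scenarios and `m` items: `a` lists the
capacity, the sizes, and the weights row by row. The accuracy is `1 / N`. -/
structure IntKnapsack where
  n : ℕ
  m : ℕ
  N : ℕ
  a : ℕ → ℕ

/-! ### The integral problem: rounded weights, parameters, and the dynamic program. -/

namespace IntKnapsack

open Finset

variable (J : IntKnapsack)

def cap : ℕ := J.a 0

def sz (e : ℕ) : ℕ := J.a (1 + e)

def wt (k e : ℕ) : ℕ := J.a (1 + J.m + (k * J.m + e))

/-- The largest weight in scenario `k` among the first `i` items that fit into the knapsack. -/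
def top (k : ℕ) : ℕ → ℕ
  | 0 => 0
  | e + 1 => max (top k e) (J.wt k e * (1 - (J.sz e - J.cap)))

/-- The minimum of `top k` over the first scenarios, where `0` stands for infinity. -/
def low : ℕ → ℕ
  | 0 => 0
  -- The factor `1 - low k` is `1` exactly when `low k` is `0`; the minimum then vanishes and the
  -- new value is taken over.
  | k + 1 => min (low k) (J.top k J.m) + (1 - low k) * J.top k J.m

/-- The order of magnitude of the optimum. -/
def L : ℕ := J.low J.n

/-- The scaling factor of the rounded weights. -/
def K : ℕ := 2 * J.N * J.m * (J.m + 2)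

/-- The bound at which rounded weights are truncated. -/
def B : ℕ := 2 * J.N * J.K * (J.m * J.m)

/-- Bounds the rounded value of every solution, hence also the change of a scenario weight in one
round. -/
def V : ℕ := J.m * J.B

/-- The number of rounds. -/
def T : ℕ := 2 * J.n * (J.V * J.V + 1)

/-- The rounded and truncated weights. -/
def rwt (k e : ℕ) : ℕ := min J.B (J.wt k e * J.K / J.L)

/-- A number that encodes the size of an item and its index. -/
def key (e : ℕ) : ℕ := J.sz e * 2 ^ J.m + 2 ^ e

/-- A set fits into the knapsack if and only if its total key is less than this number. -/
def inf : ℕ := (J.cap + 1) * 2 ^ J.m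

/-- The least total key of a subset of the first `i` items with profit exactly `p`
(or `inf` if no such set fits into the knapsack). -/
def dp (c : ℕ → ℕ) : ℕ → ℕ → ℕ
  -- By truncated subtraction `1 - (1 - p)` is `0` for `p = 0` and `1` otherwise. In the next case
  -- the summand `(c i - p) * J.inf` disqualifies taking item `i` when its profit exceeds `p`.
  | 0, p => J.inf * (1 - (1 - p))
  | i + 1, p => min (dp c i p) (dp c i (p - c i) + J.key i + (c i - p) * J.inf)

/-- The largest profit less than `r` of a set that fits into the knapsack. -/
def best (c : ℕ → ℕ) : ℕ → ℕ
  | 0 => 0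
  | p + 1 => max (best c p) (p * (1 - (1 - (J.inf - J.dp c J.m p))))

/-- `x` is the indicator of a set that fits into the knapsack. -/
def Sol (x : ℕ → ℕ) : Prop := (∀ e, x e ≤ 1) ∧ ∑ e ∈ range J.m, J.sz e * x e ≤ J.cap

/-- The rounded value of a set in scenario `k`. -/
def val (k : ℕ) (x : ℕ → ℕ) : ℕ := ∑ e ∈ range J.m, J.rwt k e * x e

variable {J}

theorem dp_le_inf (c : ℕ → ℕ) (i p : ℕ) : J.dp c i p ≤ J.inf := by
  induction i with
  | zero =>
    calc J.inf * (1 - (1 - p)) ≤ J.inf * 1 := Nat.mul_le_mul_left _ (Nat.sub_le _ _)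
      _ = _ := mul_one _
  | succ i ih => exact (min_le_left _ _).trans ih

theorem dp_le (c x : ℕ → ℕ) (hx : ∀ e, x e ≤ 1) (i : ℕ) :
    J.dp c i (∑ e ∈ range i, c e * x e) ≤ ∑ e ∈ range i, J.key e * x e := by
  induction i with
  | zero => simp [dp]
  | succ i ih =>
    rw [sum_range_succ, sum_range_succ, dp]
    rcases Nat.le_one_iff_eq_zero_or_eq_one.1 (hx i) with h | h
    · simp only [h, mul_zero, add_zero]
      exact (min_le_left _ _).trans ih
    · simp only [h, mul_one, Nat.add_sub_cancel]
      refine (min_le_right _ _).trans ?_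
      rw [Nat.sub_eq_zero_of_le (Nat.le_add_left _ _)]
      omega

/-- Backtracking: the branch attaining the minimum decides whether item `i` is taken. The penalty
keeps a value below `J.inf` from arising by an inadmissible subtraction. -/
theorem exists_of_dp_lt (c : ℕ → ℕ) (i p : ℕ) (h : J.dp c i p < J.inf) :
    ∃ x : ℕ → ℕ, (∀ e, x e ≤ 1) ∧ ∑ e ∈ range i, c e * x e = p ∧
      ∑ e ∈ range i, J.key e * x e = J.dp c i p := by
  induction i generalizing p with
  | zero =>
    have hp : p = 0 := by
      by_contra hp
      simp [dp, show 1 - p = 0 by omega] at h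
    exact ⟨0, by simp, by simp [hp], by simp [dp, hp]⟩
  | succ i ih =>
    rw [dp] at h ⊢
    rcases le_total (J.dp c i p) (J.dp c i (p - c i) + J.key i + (c i - p) * J.inf) with hle | hle
    · rw [min_eq_left hle] at h ⊢
      obtain ⟨x, h1, h2, h3⟩ := ih p h
      refine ⟨Function.update x i 0, fun e => ?_, ?_, ?_⟩
      · by_cases he : e = i
        · simp [he]
        · simpa [he] using h1 e
      · rw [sum_range_succ, ← h2]
        simp only [Function.update_self, mul_zero, add_zero]
        exact sum_congr rfl fun e he => by rw [Function.update_of_ne (by simp at he; omega)]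
      · rw [sum_range_succ, ← h3]
        simp only [Function.update_self, mul_zero, add_zero]
        exact sum_congr rfl fun e he => by rw [Function.update_of_ne (by simp at he; omega)]
    · rw [min_eq_right hle] at h ⊢
      have hc : c i ≤ p := by
        by_contra hc
        have : 1 * J.inf ≤ (c i - p) * J.inf := Nat.mul_le_mul_right _ (by omega)
        omega
      rw [Nat.sub_eq_zero_of_le hc, zero_mul, add_zero] at h ⊢
      obtain ⟨x, h1, h2, h3⟩ := ih (p - c i) (by omega)
      refine ⟨Function.update x i 1, fun e => ?_, ?_, ?_⟩
      · by_cases he : e = i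
        · simp [he]
        · simpa [he] using h1 e
      · rw [sum_range_succ, ← Nat.sub_add_cancel hc, ← h2]
        simp only [Function.update_self, mul_one]
        congr 1
        exact sum_congr rfl fun e he => by rw [Function.update_of_ne (by simp at he; omega)]
      · rw [sum_range_succ, ← h3]
        simp only [Function.update_self, mul_one]
        congr 1
        exact sum_congr rfl fun e he => by rw [Function.update_of_ne (by simp at he; omega)]

theorem sum_two_pow_lt (x : ℕ → ℕ) (hx : ∀ e, x e ≤ 1) (m : ℕ) :
    ∑ e ∈ range m, 2 ^ e * x e < 2 ^ m := by
  induction m with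
  | zero => simp
  | succ m ih =>
    rw [sum_range_succ, pow_succ]
    have : 2 ^ m * x m ≤ 2 ^ m * 1 := Nat.mul_le_mul_left _ (hx m)
    omega

/-- The lower part is the binary expansion of the indicator and the multiple of `2 ^ m` does not
affect its bits, so a total key reveals its set and no backtracking is needed at run time. `H` is
general so that the induction can absorb the leading bit. -/
theorem bit_eq (x : ℕ → ℕ) (hx : ∀ e, x e ≤ 1) (m : ℕ) (H : ℕ) {j : ℕ} (hj : j < m) :
    (H * 2 ^ m + ∑ e ∈ range m, 2 ^ e * x e) / 2 ^ j % 2 = x j := by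
  induction m generalizing H with
  | zero => omega
  | succ m ih =>
    have e : H * 2 ^ (m + 1) + ∑ e ∈ range (m + 1), 2 ^ e * x e =
        (2 * H + x m) * 2 ^ m + ∑ e ∈ range m, 2 ^ e * x e := by
      rw [sum_range_succ]; ring
    rw [e]
    rcases Nat.lt_succ_iff_lt_or_eq.1 hj with h | rfl
    · exact ih _ h
    · rw [add_comm, Nat.add_mul_div_right _ _ (by positivity),
        Nat.div_eq_of_lt (sum_two_pow_lt x hx j)]
      have := hx j
      omega

theorem sum_key (x : ℕ → ℕ) : ∑ e ∈ range J.m, J.key e * x e =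
    (∑ e ∈ range J.m, J.sz e * x e) * 2 ^ J.m + ∑ e ∈ range J.m, 2 ^ e * x e := by
  rw [sum_mul, ← sum_add_distrib]
  exact sum_congr rfl fun e _ => by rw [key]; ring

/-- The indicator part of a total key stays below `2 ^ J.m`, so it never carries into the part that
holds the size. -/
theorem sum_key_lt_inf_iff (x : ℕ → ℕ) (hx : ∀ e, x e ≤ 1) :
    ∑ e ∈ range J.m, J.key e * x e < J.inf ↔ ∑ e ∈ range J.m, J.sz e * x e ≤ J.cap := by
  rw [sum_key, inf]
  have h := sum_two_pow_lt x hx J.m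
  constructor
  · intro h1
    by_contra! h2
    have : (J.cap + 1) * 2 ^ J.m ≤ (∑ e ∈ range J.m, J.sz e * x e) * 2 ^ J.m :=
      Nat.mul_le_mul_right _ h2
    omega
  · intro h1
    have : (∑ e ∈ range J.m, J.sz e * x e) * 2 ^ J.m ≤ J.cap * 2 ^ J.m :=
      Nat.mul_le_mul_right _ h1
    rw [add_mul]
    omega

theorem le_best (c : ℕ → ℕ) {p r : ℕ} (hp : p < r) (h : J.dp c J.m p < J.inf) :
    p ≤ J.best c r := by
  induction r with
  | zero => omega
  | succ r ih =>
    rw [best]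
    rcases Nat.lt_succ_iff_lt_or_eq.1 hp with h' | rfl
    · exact (ih h').trans (le_max_left _ _)
    · refine le_trans ?_ (le_max_right _ _)
      rw [show 1 - (1 - (J.inf - J.dp c J.m p)) = 1 by omega, mul_one]

theorem best_le (c : ℕ → ℕ) (r : ℕ) : J.best c r ≤ r := by
  induction r with
  | zero => rfl
  | succ r ih =>
    rw [best]
    have : r * (1 - (1 - (J.inf - J.dp c J.m r))) ≤ r * 1 :=
      Nat.mul_le_mul_left _ (Nat.sub_le _ _)
    omega

theorem dp_best_lt (c : ℕ → ℕ) (r : ℕ) : J.dp c J.m (J.best c r) < J.inf := by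
  have h0 : J.dp c J.m 0 < J.inf := by
    have h1 := J.dp_le c 0 (by simp) J.m
    simp only [Pi.zero_apply, mul_zero, sum_const_zero] at h1
    exact h1.trans_lt (Nat.mul_pos (Nat.succ_pos _) (by positivity))
  induction r with
  | zero => exact h0
  | succ r ih =>
    rw [best]
    rcases max_choice (J.best c r) (r * (1 - (1 - (J.inf - J.dp c J.m r)))) with h | h <;> rw [h]
    · exact ih
    · by_cases hr : J.dp c J.m r < J.inf
      · rwa [show 1 - (1 - (J.inf - J.dp c J.m r)) = 1 by omega, mul_one]
      · rwa [show 1 - (1 - (J.inf - J.dp c J.m r)) = 0 by omega, mul_zero]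

/-- The dynamic program finds a solution of maximum profit. -/
theorem exists_opt (c : ℕ → ℕ) (r : ℕ) (hr : ∑ e ∈ range J.m, c e < r) :
    ∃ x, J.Sol x ∧ ∑ e ∈ range J.m, c e * x e = J.best c r ∧
      (∀ x', J.Sol x' → ∑ e ∈ range J.m, c e * x' e ≤ J.best c r) ∧
      ∀ e < J.m, J.dp c J.m (J.best c r) / 2 ^ e % 2 = x e := by
  obtain ⟨x, h1, h2, h3⟩ := exists_of_dp_lt c J.m _ (J.dp_best_lt c r)
  refine ⟨x, ⟨h1, ?_⟩, h2, fun x' hx' => ?_, fun e he => ?_⟩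
  · rw [← sum_key_lt_inf_iff x h1, h3]
    exact J.dp_best_lt c r
  · refine le_best c (lt_of_le_of_lt (sum_le_sum fun e _ => ?_) hr)
      ((dp_le c x' hx'.1 J.m).trans_lt ((sum_key_lt_inf_iff x' hx'.1).2 hx'.2))
    exact (Nat.mul_le_mul_left _ (hx'.1 e)).trans (mul_one _).le
  · rw [← h3, sum_key, bit_eq x h1 _ _ he]

/-! ### Repeated play: the quadratic potential and the progress invariant. -/

/-- The updated weight of a scenario with weight `y` and value `s` when the average is `v`. -/
def upd (y v s : ℕ) : ℕ := 1 + ((y + v) - (s + 1))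

/-- Expanding the square of `y + v - s` gives a cross term that `h` makes nonpositive in total and a
square of at most `V * V`. The extra `1` per scenario pays for raising a weight to the floor value
`1`. -/
theorem sum_upd_sq_le (n V : ℕ) (y s : ℕ → ℕ) (v : ℕ) (hv : v ≤ V) (hs : ∀ k < n, s k ≤ V)
    (h : v * ∑ k ∈ range n, y k ≤ ∑ k ∈ range n, y k * s k) :
    ∑ k ∈ range n, upd (y k) v (s k) ^ 2 ≤ ∑ k ∈ range n, y k ^ 2 + n * (V * V + 1) := by
  have h1 : ∀ k ∈ range n, ((upd (y k) v (s k) : ℕ) : ℤ) ^ 2 ≤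
      (y k : ℤ) ^ 2 + 2 * (v * y k - y k * s k) + (V * V + 1) := by
    intro k hk
    have hsk := hs k (mem_range.1 hk)
    have hd : ((v : ℤ) - s k) ^ 2 ≤ V * V := by
      rw [← sq]
      exact sq_le_sq' (by omega) (by omega)
    by_cases hle : s k + 1 ≤ y k + v
    · have : ((upd (y k) v (s k) : ℕ) : ℤ) = y k + v - s k := by unfold upd; omega
      rw [this]
      nlinarith
    · have : ((upd (y k) v (s k) : ℕ) : ℤ) = 1 := by unfold upd; omega
      rw [this]
      -- Here `y ^ 2 + 2 * y * (v - s) = (y + v - s) ^ 2 - (v - s) ^ 2 ≥ -V ^ 2`, so the right side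
      -- is at least `1`.
      nlinarith [sq_nonneg ((y k : ℤ) + v - s k)]
  have h2 := sum_le_sum h1
  simp only [sum_add_distrib, ← mul_sum, sum_sub_distrib, sum_const, card_range,
    nsmul_eq_mul] at h2
  zify at h ⊢
  linarith

/-- Against all weights on the scenarios, some solution has average rounded value at least `g`. -/
def Attainable (J : IntKnapsack) (g : ℕ) : Prop :=
  ∀ y : ℕ → ℕ, ∃ x, J.Sol x ∧
    g * ∑ k ∈ range J.n, y k ≤ ∑ k ∈ range J.n, y k * J.val k x

theorem le_upd_add (y v s : ℕ) : y + v ≤ upd y v s + s := by unfold upd; omega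

theorem val_le (k : ℕ) {x : ℕ → ℕ} (hx : J.Sol x) : J.val k x ≤ J.V := by
  calc J.val k x ≤ ∑ e ∈ range J.m, J.B * 1 :=
        sum_le_sum fun e _ => Nat.mul_le_mul (min_le_left _ _) (hx.1 e)
    _ = J.V := by simp [V]

/-- The state of the weights after `t` rounds in which the solutions `X 0, …, X (t - 1)`
have been chosen. -/
structure Progress (J : IntKnapsack) (t : ℕ) (y : ℕ → ℕ) (X : ℕ → ℕ → ℕ) : Prop where
  pos : ∀ k < J.n, 1 ≤ y k
  sum_sq : ∑ k ∈ range J.n, y k ^ 2 ≤ J.n + t * (J.n * (J.V * J.V + 1))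
  sol : ∀ s < t, J.Sol (X s)
  gain : ∀ g, J.Attainable g → ∀ k < J.n, t * g ≤ y k + ∑ s ∈ range t, J.val k (X s)

/-- This is where the number of rounds comes from. With `z = n * (V * V + 1)` and `T = 2 * z` the
potential is at most `z + 2 * z ^ 2 ≤ T ^ 2`, so after `T` rounds a weight amounts to at most one
unit per round. -/
theorem Progress.le {t : ℕ} {y : ℕ → ℕ} {X : ℕ → ℕ → ℕ} (h : J.Progress t y X) (ht : t ≤ J.T)
    {k : ℕ} (hk : k < J.n) : y k ≤ J.T := by
  have h1 : y k ^ 2 ≤ ∑ k ∈ range J.n, y k ^ 2 :=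
    single_le_sum (f := fun k => y k ^ 2) (fun _ _ => Nat.zero_le _) (mem_range.2 hk)
  have h2 := h.sum_sq
  have h3 : t * (J.n * (J.V * J.V + 1)) ≤ J.T * (J.n * (J.V * J.V + 1)) :=
    Nat.mul_le_mul_right _ ht
  have h4 : 2 * (J.n * (J.V * J.V + 1)) = J.T := by rw [T]; ring
  have h5 : J.n ≤ J.n * (J.V * J.V + 1) := Nat.le_mul_of_pos_right _ (Nat.succ_pos _)
  generalize J.n * (J.V * J.V + 1) = z at *
  have h6 : y k ^ 2 ≤ J.T ^ 2 := by
    rw [← h4] at h3 ⊢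
    have : z * 1 ≤ z * z := Nat.mul_le_mul_left _ (by omega)
    nlinarith
  exact (Nat.pow_le_pow_iff_left (by norm_num)).1 h6

theorem Progress.zero (X : ℕ → ℕ → ℕ) : J.Progress 0 (fun _ => 1) X where
  pos := fun _ _ => le_rfl
  sum_sq := by simp
  sol := by simp
  gain := by simp

theorem Progress.succ {t : ℕ} {y y' : ℕ → ℕ} {X : ℕ → ℕ → ℕ} {v : ℕ} (h : J.Progress t y X)
    (hn : 0 < J.n) (hX : J.Sol (X t))
    (hopt : ∀ x, J.Sol x → ∑ k ∈ range J.n, y k * J.val k x ≤ ∑ k ∈ range J.n, y k * J.val k (X t))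
    (hv : v = (∑ k ∈ range J.n, y k * J.val k (X t)) / ∑ k ∈ range J.n, y k)
    (hy : ∀ k < J.n, y' k = upd (y k) v (J.val k (X t))) : J.Progress (t + 1) y' X := by
  have hY : 0 < ∑ k ∈ range J.n, y k :=
    sum_pos (fun k hk => h.pos k (mem_range.1 hk)) ⟨0, mem_range.2 hn⟩
  refine ⟨fun k hk => ?_, ?_, fun s hs => ?_, fun g hg k hk => ?_⟩
  · rw [hy k hk, upd]; omega
  · rw [sum_congr rfl fun k hk => by rw [hy k (mem_range.1 hk)]]
    refine (sum_upd_sq_le J.n J.V y (fun k => J.val k (X t)) v ?_ (fun k _ => val_le k hX)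
      ?_).trans ?_
    · rw [hv]
      refine Nat.div_le_of_le_mul ?_
      rw [sum_mul]
      exact sum_le_sum fun k _ => Nat.mul_le_mul_left _ (val_le k hX)
    · rw [hv]
      exact Nat.div_mul_le_self _ _
    · have := h.sum_sq
      rw [add_mul, one_mul]
      omega
  · rcases Nat.lt_succ_iff_lt_or_eq.1 hs with hs | rfl
    · exact h.sol s hs
    · exact hX
  · have h1 : g ≤ v := by
      obtain ⟨x, hx, hgx⟩ := hg y
      rw [hv, Nat.le_div_iff_mul_le hY]
      exact hgx.trans (hopt x hx)
    have h2 := h.gain g hg k hk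
    have h3 := le_upd_add (y k) v (J.val k (X t))
    rw [← hy k hk] at h3
    rw [sum_range_succ, add_mul]
    omega

end IntKnapsack

/-! ### The random access machine program. -/

namespace RobustKnapsackProgram

open Ram Finset IntKnapsack

/-! Banks: `0` input, `1` output, `2` common denominator, `3` integral data, `4` powers of two,
`5` order of magnitude of the optimum, `6` rounded weights, `7` weights of the scenarios, `8` their
sum, `9` profits, `10` table of the dynamic program, `11` maximum profit, `14` and `15`
accumulators, `20` to `24` loop counters. -/

def eN : Expr := rd 0 0
def en : Expr := rd 0 1
def em : Expr := rd 0 2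
def eK : Expr := 2 * eN * em * (em + 2)
def eB : Expr := 2 * eN * eK * (em * em)
def eV : Expr := em * eB
def eT : Expr := 2 * en * (eV * eV + 1)
def eInf : Expr := (rd 3 0 + 1) * rd 4 em
def eR : Expr := var 8 * eV + 1
def eMax (a b : Expr) : Expr := a + (b - a)
def eMin (a b : Expr) : Expr := a - (a - b)

/-- After the accuracy and the two dimensions, rational number `i` of the input occupies cells `3 +
2 * i` and `4 + 2 * i`. -/
def denominator : Prog :=
  .seq (.store 2 0 1) (forLoop 20 (1 + em + en * em) (.store 2 0 (var 2 * rd 0 (4 + 2 * var 20))))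

def integralData : Prog :=
  forLoop 20 (1 + em + en * em)
    (.store 3 (var 20) (rd 0 (3 + 2 * var 20) * (var 2 / rd 0 (4 + 2 * var 20))))

def powers : Prog :=
  .seq (.store 4 0 1) (forLoop 20 em (.store 4 (var 20 + 1) (2 * rd 4 (var 20))))

def magnitude : Prog :=
  .seq (.store 5 0 0) (forLoop 21 en (.seq (.store 15 0 0) (.seq
    (forLoop 20 em (.store 15 0 (eMax (var 15)
      (rd 3 (1 + em + (var 21 * em + var 20)) * (1 - (rd 3 (1 + var 20) - rd 3 0))))))
    (.store 5 0 (eMin (var 5) (var 15) + (1 - var 5) * var 15)))))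

def roundedWeights : Prog :=
  forLoop 20 (en * em) (.store 6 (var 20) (eMin eB (rd 3 (1 + em + var 20) * eK / var 5)))

def initialWeights : Prog := forLoop 21 en (.store 7 (var 21) 1)

def totalWeight : Prog :=
  .seq (.store 8 0 0) (forLoop 21 en (.store 8 0 (var 8 + rd 7 (var 21))))

def profits : Prog :=
  forLoop 20 em (.seq (.store 14 0 0) (.seq
    (forLoop 21 en (.store 14 0 (var 14 + rd 7 (var 21) * rd 6 (var 21 * em + var 20))))
    (.store 9 (var 20) (var 14))))

def dynamicProgram : Prog :=
  .seq (forLoop 23 eR (.store 10 (var 23) (eInf * (1 - (1 - var 23)))))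
    (forLoop 24 em (forLoop 23 eR (.store 10 ((var 24 + 1) * eR + var 23)
      (eMin (rd 10 (var 24 * eR + var 23))
        (rd 10 (var 24 * eR + (var 23 - rd 9 (var 24)))
          + (rd 3 (1 + var 24) * rd 4 em + rd 4 (var 24))
          + (rd 9 (var 24) - var 23) * eInf)))))

def maximumProfit : Prog :=
  .seq (.store 11 0 0) (forLoop 23 eR (.store 11 0
    (eMax (var 11) (var 23 * (1 - (1 - (eInf - rd 10 (em * eR + var 23))))))))

def eKey : Expr := rd 10 (em * eR + var 11)

def writeRecord : Prog :=
  .seq (.store 1 (1 + var 22 * (em + 2)) 1) (.seq (.store 1 (2 + var 22 * (em + 2)) eT)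
    (forLoop 20 em (.store 1 (3 + var 22 * (em + 2) + var 20)
      -- Bit `e` of the optimal key is `⌊d / 2 ^ e⌋ - 2 * ⌊d / 2 ^ (e + 1)⌋`; the machine has no
      -- remainder operation.
      (eKey / rd 4 (var 20) - 2 * (eKey / rd 4 (var 20 + 1))))))

def updateWeights : Prog :=
  forLoop 21 en (.seq (.store 14 0 0) (.seq
    (forLoop 20 em (.store 14 0
      (var 14 + rd 6 (var 21 * em + var 20) * rd 1 (3 + var 22 * (em + 2) + var 20))))
    (.store 7 (var 21) (1 + ((rd 7 (var 21) + var 11 / var 8) - (var 14 + 1))))))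

def round : Prog :=
  .seq totalWeight (.seq profits (.seq dynamicProgram (.seq maximumProfit
    (.seq writeRecord updateWeights))))

def program : Prog :=
  .seq denominator (.seq integralData (.seq powers (.seq magnitude (.seq roundedWeights
    (.seq initialWeights (.seq (forLoop 22 eT round) (.store 1 0 eT)))))))

/-! ### Correctness of the steps of one round. -/

variable {β Q : ℕ} {J : IntKnapsack}

@[simp] theorem eval_eMax (σ : Mem) (a b : Expr) :
    (eMax a b).eval σ = max (a.eval σ) (b.eval σ) := by simp [eMax]; omega

@[simp] theorem eval_eMin (σ : Mem) (a b : Expr) :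
    (eMin a b).eval σ = min (a.eval σ) (b.eval σ) := by simp [eMin]; omega

/-- The numbers that occur in the computation fit into `β` bits, and `Q` bounds the numbers of
rounds of the loops. -/
structure Fits (J : IntKnapsack) (β Q : ℕ) : Prop where
  n_pos : 0 < J.n
  m_pos : 0 < J.m
  lt : Q < 2 ^ β
  entries : 1 + J.m + J.n * J.m ≤ Q
  table : J.n * J.T * J.V + 1 ≤ Q
  weight : J.n * J.T ≤ Q
  upd : J.T + J.V + 1 ≤ Q
  B : J.B ≤ Q
  inf : J.inf < 2 ^ β
  data : ∀ i < 1 + J.m + J.n * J.m, J.a i < 2 ^ β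

theorem Fits.n_le (F : Fits J β Q) : J.n ≤ Q := by
  have := F.entries
  have := Nat.le_mul_of_pos_right J.n F.m_pos
  omega

theorem Fits.m_le (F : Fits J β Q) : J.m ≤ Q := by
  have := F.entries
  omega

theorem index_lt {k e n m : ℕ} (hk : k < n) (he : e < m) : k * m + e < n * m := by
  calc k * m + e < k * m + m := by omega
    _ = (k + 1) * m := by ring
    _ ≤ n * m := Nat.mul_le_mul_right _ hk

/-- The first entries of the input. -/
structure Header (J : IntKnapsack) (σ : Mem) : Prop where
  N : σ 0 0 = J.N
  n : σ 0 1 = J.n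
  m : σ 0 2 = J.m

theorem Header.of_eq {σ τ : Mem} (h : Header J σ) (e : τ 0 = σ 0) : Header J τ :=
  ⟨by rw [e, h.N], by rw [e, h.n], by rw [e, h.m]⟩

section

variable {σ : Mem}

theorem Header.eval_en (h : Header J σ) : en.eval σ = J.n := by simp [en, h.n]
theorem Header.eval_em (h : Header J σ) : em.eval σ = J.m := by simp [em, h.m]
theorem Header.eval_eK (h : Header J σ) : eK.eval σ = J.K := by
  simp [eK, eN, em, h.N, h.m, IntKnapsack.K]
theorem Header.eval_eB (h : Header J σ) : eB.eval σ = J.B := by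
  simp [eB, eN, em, h.N, h.m, h.eval_eK, IntKnapsack.B]
theorem Header.eval_eV (h : Header J σ) : eV.eval σ = J.V := by
  simp [eV, h.eval_em, h.eval_eB, IntKnapsack.V]
theorem Header.eval_eT (h : Header J σ) : eT.eval σ = J.T := by
  simp [eT, h.eval_en, h.eval_eV, IntKnapsack.T]

end

/-- The memory holds the data used by the rounds. -/
structure Ready (J : IntKnapsack) (σ : Mem) : Prop extends Header J σ where
  cap : σ 3 0 = J.cap
  sz : ∀ e < J.m, σ 3 (1 + e) = J.sz e
  pow : ∀ e ≤ J.m, σ 4 e = 2 ^ e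
  rwt : ∀ k < J.n, ∀ e < J.m, σ 6 (k * J.m + e) = J.rwt k e

theorem Ready.of_agree {σ τ : Mem} {l : List ℕ} (h : Ready J σ) (hA : Agree l σ τ)
    (h0 : 0 ∉ l) (h3 : 3 ∉ l) (h4 : 4 ∉ l) (h6 : 6 ∉ l) : Ready J τ := by
  refine ⟨h.toHeader.of_eq (hA 0 h0), ?_, ?_, ?_, ?_⟩
  · rw [hA 3 h3, h.cap]
  · rw [hA 3 h3]; exact h.sz
  · rw [hA 4 h4]; exact h.pow
  · rw [hA 6 h6]; exact h.rwt

theorem Ready.eval_eInf {σ : Mem} (h : Ready J σ) : eInf.eval σ = J.inf := by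
  simp [eInf, h.cap, h.eval_em, h.pow, IntKnapsack.inf]

/-- The profit of an item with respect to the weights `y` of the scenarios. -/
def profit (J : IntKnapsack) (y : ℕ → ℕ) (e : ℕ) : ℕ := ∑ k ∈ range J.n, y k * J.rwt k e

/-- The width of the table of the dynamic program. -/
def width (J : IntKnapsack) (y : ℕ → ℕ) : ℕ := (∑ k ∈ range J.n, y k) * J.V + 1

/-- Ensures that every achievable profit has its own column in the table. -/
theorem sum_profit_lt (y : ℕ → ℕ) : ∑ e ∈ range J.m, profit J y e < width J y := by
  have h : ∀ e ∈ range J.m, profit J y e ≤ (∑ k ∈ range J.n, y k) * J.B := fun e _ => by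
    rw [profit, sum_mul]
    exact sum_le_sum fun k _ => Nat.mul_le_mul_left _ (min_le_left _ _)
  refine Nat.lt_succ_of_le ((sum_le_sum h).trans ?_)
  simp only [sum_const, card_range, smul_eq_mul, IntKnapsack.V]
  exact le_of_eq (by ring)

/-- Exchanging the sums turns the best response to scenario weights into a knapsack problem with a
single profit function. -/
theorem sum_profit_mul (y x : ℕ → ℕ) :
    ∑ e ∈ range J.m, profit J y e * x e = ∑ k ∈ range J.n, y k * J.val k x := by
  simp only [profit, IntKnapsack.val, sum_mul, mul_sum]
  rw [sum_comm]
  exact sum_congr rfl fun k _ => sum_congr rfl fun e _ => by ring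

/-- The weights of the scenarios in the memory. -/
structure Weights (J : IntKnapsack) (y : ℕ → ℕ) (σ : Mem) : Prop where
  le : ∀ k < J.n, y k ≤ J.T
  eq : ∀ k < J.n, σ 7 k = y k

variable {y : ℕ → ℕ}

theorem Weights.of_eq {σ τ : Mem} (h : Weights J y σ) (e : τ 7 = σ 7) : Weights J y τ :=
  ⟨h.le, by rw [e]; exact h.eq⟩

theorem sum_range_le_mul {f : ℕ → ℕ} {n b i : ℕ} (h : ∀ k < n, f k ≤ b) (hi : i ≤ n) :
    ∑ k ∈ range i, f k ≤ n * b := by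
  calc ∑ k ∈ range i, f k ≤ ∑ k ∈ range i, b :=
        sum_le_sum fun k hk => h k ((mem_range.1 hk).trans_le hi)
    _ = i * b := by simp
    _ ≤ n * b := Nat.mul_le_mul_right _ hi

theorem width_le (F : Fits J β Q) (hy : ∀ k < J.n, y k ≤ J.T) : width J y ≤ Q := by
  refine le_trans ?_ F.table
  exact Nat.succ_le_succ (Nat.mul_le_mul_right _ (sum_range_le_mul hy le_rfl))

theorem runs_totalWeight (F : Fits J β Q) {σ : Mem} (h : Header J σ) (hy : Weights J y σ) :
    Runs β Q totalWeight σ fun τ => τ 8 0 = ∑ k ∈ range J.n, y k := by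
  refine (Runs.store (φ := fun τ => τ 8 0 = 0) (by simp) (by simp [write_same])).seq fun σ₁ h₁ e₁ => ?_
  have h₁' := h.of_eq (h₁ 0 (by decide))
  refine Runs.fold J.n (fun i => ∑ k ∈ range i, y k) F.n_le F.lt (by decide)
    (fun τ hτ => (h₁'.of_eq (hτ 0 (by decide))).eval_en) (fun i hi => ?_) (by simp [e₁]) ?_
  · exact ((sum_range_le_mul hy.le hi).trans F.weight).trans_lt F.lt
  · intro i hi τ hτ hx hacc
    rw [sum_range_succ]
    simp [hacc, hx, hτ 7 (by decide), h₁ 7 (by decide), hy.eq i hi]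

theorem profit_le (F : Fits J β Q) (hy : ∀ k < J.n, y k ≤ J.T) (e i : ℕ) (hi : i ≤ J.n) :
    ∑ k ∈ range i, y k * J.rwt k e ≤ Q := by
  have h1 : ∑ k ∈ range i, y k * J.rwt k e ≤ J.n * (J.T * J.B) :=
    sum_range_le_mul (fun k hk => Nat.mul_le_mul (hy k hk) (min_le_left _ _)) hi
  have h2 : J.T * J.B ≤ J.T * J.V :=
    Nat.mul_le_mul_left _ (Nat.le_mul_of_pos_left _ F.m_pos)
  have h3 : J.n * (J.T * J.V) = J.n * J.T * J.V := by ring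
  have := Nat.mul_le_mul_left J.n h2
  have := F.table
  omega

theorem runs_profits (F : Fits J β Q) {σ : Mem} (h : Ready J σ) (hy : Weights J y σ) :
    Runs β Q profits σ fun τ => ∀ e < J.m, τ 9 e = profit J y e := by
  refine Runs.forLoop J.m (fun i τ => ∀ e < i, τ 9 e = profit J y e) F.m_le F.lt (by decide)
    (fun τ hτ => (h.toHeader.of_eq (hτ 0 (by decide))).eval_em) (fun i τ v hi => ?_) (by simp) ?_
  · rwa [write_bank_ne _ _ _ (by decide)]
  intro e he τ hτ hx hI
  have hR : Ready J τ := h.of_agree hτ (by decide) (by decide) (by decide) (by decide)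
  refine (Runs.store (φ := fun τ => τ 14 0 = 0) (by simp) (by simp [write_same])).seq
    fun τ₁ h₁ e₁ => ?_
  have hR₁ : Ready J τ₁ := hR.of_agree h₁ (by decide) (by decide) (by decide) (by decide)
  refine (Runs.fold J.n (fun i => ∑ k ∈ range i, y k * J.rwt k e) F.n_le F.lt (by decide)
    (fun τ hτ => (hR₁.toHeader.of_eq (hτ 0 (by decide))).eval_en) (fun i hi => ?_) (by simp [e₁])
    ?_).seq fun τ₂ h₂ e₂ => ?_
  · exact (profit_le F hy.le e i hi).trans_lt F.lt
  · intro k hk ρ hρ hxk hacc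
    rw [sum_range_succ]
    simp [hacc, hxk, hρ 7 (by decide), h₁ 7 (by decide), hτ 7 (by decide), hy.eq k hk,
      (hR₁.toHeader.of_eq (hρ 0 (by decide))).eval_em, hρ 20 (by decide), h₁ 20 (by decide), hx,
      hρ 6 (by decide), hR₁.rwt k hk e he]
  · refine .store ?_ fun e' he' => ?_
    · simpa [e₂] using (profit_le F hy.le e J.n le_rfl).trans_lt F.lt
    · have hx₂ : (var 20).eval τ₂ = e := by simp [h₂ 20 (by decide), h₁ 20 (by decide), hx]
      rw [hx₂]
      rcases Nat.lt_succ_iff_lt_or_eq.1 he' with he' | rfl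
      · rw [write_index_ne _ _ _ he'.ne, h₂ 9 (by decide), h₁ 9 (by decide), hI e' he']
      · rw [write_same, eval_var, e₂, profit]

theorem runs_dynamicProgram (F : Fits J β Q) {σ : Mem} (h : Ready J σ) {c : ℕ → ℕ} {r : ℕ}
    (hr : r ≤ Q) (hs : σ 8 0 * J.V + 1 = r) (hc : ∀ e < J.m, σ 9 e = c e) :
    Runs β Q dynamicProgram σ fun τ => ∀ p < r, τ 10 (J.m * r + p) = J.dp c J.m p := by
  have evR : ∀ τ : Mem, τ 0 = σ 0 → τ 8 = σ 8 → eR.eval τ = r := fun τ h0 h8 => by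
    simp [eR, h8, (h.toHeader.of_eq h0).eval_eV, hs]
  refine (Runs.fill r (fun p => p) (J.dp c 0) hr F.lt (by decide)
    (fun τ hτ => evR τ (hτ 0 (by decide)) (hτ 8 (by decide))) (fun i _ j hj => hj.ne)
    (fun p _ => (dp_le_inf c 0 p).trans_lt F.inf) ?_).seq fun σ₁ h₁ e₁ => ?_
  · intro p hp τ hτ hx _ _
    have hR : Ready J τ := h.of_agree hτ (by decide) (by decide) (by decide) (by decide)
    simp [hx, hR.eval_eInf, dp]
  refine (Runs.forLoop J.m (fun i τ => ∀ i' ≤ i, ∀ p < r, τ 10 (i' * r + p) = J.dp c i' p)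
    F.m_le F.lt (by decide) (fun τ hτ => ?_) (fun i τ v hi => ?_) ?_ ?_).mono
    fun τ _ hτ p hp => hτ J.m le_rfl p hp
  · exact (h.toHeader.of_eq ((hτ 0 (by decide)).trans (h₁ 0 (by decide)))).eval_em
  · rwa [write_bank_ne _ _ _ (by decide)]
  · intro i' hi' p hp
    obtain rfl : i' = 0 := by omega
    simpa using e₁.1 p hp
  intro i hi τ hτ hx hI
  have hR₁ : Ready J σ₁ := h.of_agree h₁ (by decide) (by decide) (by decide) (by decide)
  have hR : Ready J τ := hR₁.of_agree hτ (by decide) (by decide) (by decide) (by decide)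
  have h0 : τ 0 = σ 0 := (hτ 0 (by decide)).trans (h₁ 0 (by decide))
  have h8 : τ 8 = σ 8 := (hτ 8 (by decide)).trans (h₁ 8 (by decide))
  -- Rows are stored consecutively with stride `r`, so writing row `i + 1` leaves the earlier rows
  -- intact.
  have hlt : ∀ i' ≤ i, ∀ p < r, ∀ j, i' * r + p ≠ (i + 1) * r + j := by
    intro i' hi' p hp j
    have : i' * r ≤ i * r := Nat.mul_le_mul_right _ hi'
    rw [add_mul, one_mul]
    omega
  refine (Runs.fill r (fun p => (i + 1) * r + p) (J.dp c (i + 1)) hr F.lt (by decide)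
    (fun ρ hρ => evR ρ ((hρ 0 (by decide)).trans h0) ((hρ 8 (by decide)).trans h8))
    (fun i _ j hj => by omega)
    (fun p _ => (dp_le_inf c _ p).trans_lt F.inf) ?_).mono fun ρ hρ e i' hi' p hp => ?_
  · intro p hp ρ hρ hxp _ hold
    have hRρ : Ready J ρ := hR.of_agree hρ (by decide) (by decide) (by decide) (by decide)
    have hRe := evR ρ ((hρ 0 (by decide)).trans h0) ((hρ 8 (by decide)).trans h8)
    have old : ∀ p < r, ρ 10 (i * r + p) = J.dp c i p := fun p hp => by
      rw [hold _ fun j _ => hlt i le_rfl p hp j, hI i le_rfl p hp]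
    have h9 : ρ 9 i = c i := by
      rw [hρ 9 (by decide), hτ 9 (by decide), h₁ 9 (by decide), hc i hi]
    have hxi : ρ 24 0 = i := by rw [hρ 24 (by decide), hx]
    constructor
    · simp [hxi, hRe, hxp]
    -- Even when `c i > p`, the truncated index `p - c i` stays inside row `i`, so the value read is
    -- always defined by the invariant.
    · simp only [eval_eMin, eval_rd, eval_add, eval_mul, eval_sub, eval_var, hxi, hRe, hxp, h9,
        old p hp, old (p - c i) (by omega), hRρ.sz i hi, hRρ.eval_em, hRρ.pow J.m le_rfl,
        hRρ.pow i hi.le, hRρ.eval_eInf, eval_one, dp, IntKnapsack.key]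
  · rcases Nat.le_succ_iff.1 hi' with hi' | rfl
    · rw [e.2 _ fun j _ => hlt i' hi' p hp j, hI i' hi' p hp]
    · exact e.1 p hp

theorem runs_maximumProfit (F : Fits J β Q) {σ : Mem} (h : Ready J σ) {c : ℕ → ℕ} {r : ℕ}
    (hr : r ≤ Q) (hs : σ 8 0 * J.V + 1 = r)
    (ht : ∀ p < r, σ 10 (J.m * r + p) = J.dp c J.m p) :
    Runs β Q maximumProfit σ fun τ => τ 11 0 = J.best c r := by
  refine (Runs.store (φ := fun τ => τ 11 0 = 0) (by simp) (by simp [write_same])).seq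
    fun σ₁ h₁ e₁ => ?_
  have evR : ∀ τ : Mem, Agree [23, 11] σ₁ τ → eR.eval τ = r := fun τ hτ => by
    simp [eR, hτ 8 (by decide), h₁ 8 (by decide),
      (h.toHeader.of_eq ((hτ 0 (by decide)).trans (h₁ 0 (by decide)))).eval_eV, hs]
  refine Runs.fold r (J.best c) hr F.lt (by decide) evR (fun i hi => ?_) e₁ ?_
  · exact ((best_le c i).trans (hi.trans hr)).trans_lt F.lt
  · intro p hp τ hτ hx hacc
    have hR : Ready J τ := (h.of_agree h₁ (by decide) (by decide) (by decide) (by decide)).of_agree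
      hτ (by decide) (by decide) (by decide) (by decide)
    simp [hacc, hx, hR.eval_eInf, hR.eval_em, evR τ hτ, hτ 10 (by decide), h₁ 10 (by decide),
      ht p hp, best]

theorem runs_writeRecord (F : Fits J β Q) {σ : Mem} (h : Ready J σ) {r b t d : ℕ}
    (hs : σ 8 0 * J.V + 1 = r) (hb : σ 11 0 = b) (hd : σ 10 (J.m * r + b) = d)
    (ht : σ 22 0 = t) :
    Runs β Q writeRecord σ fun τ =>
      τ 1 (1 + t * (J.m + 2)) = 1 ∧ τ 1 (2 + t * (J.m + 2)) = J.T ∧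
      (∀ e < J.m, τ 1 (3 + t * (J.m + 2) + e) = d / 2 ^ e % 2) ∧
      ∀ a < 1 + t * (J.m + 2), τ 1 a = σ 1 a := by
  have hT : J.T < 2 ^ β := by have := F.upd; have := F.lt; omega
  refine (Runs.store (φ := fun τ => τ 1 (1 + t * (J.m + 2)) = 1 ∧
    ∀ a < 1 + t * (J.m + 2), τ 1 a = σ 1 a) ?_ ?_).seq fun σ₁ h₁ e₁ => ?_
  · have := F.upd; have := F.lt; simp only [eval_one]; omega
  · have : (1 + var 22 * (em + 2)).eval σ = 1 + t * (J.m + 2) := by simp [ht, h.eval_em]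
    rw [this]
    exact ⟨write_same _ _ _ _, fun a ha => write_index_ne _ _ _ ha.ne⟩
  have hR₁ : Ready J σ₁ := h.of_agree h₁ (by decide) (by decide) (by decide) (by decide)
  have ht₁ : σ₁ 22 0 = t := by rw [h₁ 22 (by decide), ht]
  refine (Runs.store (φ := fun τ => τ 1 (1 + t * (J.m + 2)) = 1 ∧ τ 1 (2 + t * (J.m + 2)) = J.T ∧
    ∀ a < 1 + t * (J.m + 2), τ 1 a = σ 1 a) ?_ ?_).seq fun σ₂ h₂ e₂ => ?_
  · rwa [hR₁.eval_eT]
  · have : (2 + var 22 * (em + 2)).eval σ₁ = 2 + t * (J.m + 2) := by simp [ht₁, hR₁.eval_em]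
    rw [this, hR₁.eval_eT]
    refine ⟨?_, write_same _ _ _ _, fun a ha => ?_⟩
    · rw [write_index_ne _ _ _ (by omega), e₁.1]
    · rw [write_index_ne _ _ _ (by omega), e₁.2 a ha]
  have hR₂ : Ready J σ₂ := hR₁.of_agree h₂ (by decide) (by decide) (by decide) (by decide)
  refine (Runs.fill J.m (fun e => 3 + t * (J.m + 2) + e) (fun e => d / 2 ^ e % 2) F.m_le F.lt
    (by decide) (fun τ hτ => (hR₂.toHeader.of_eq (hτ 0 (by decide))).eval_em)
    (fun i _ j hj => by omega) (fun e _ => ?_) ?_).mono fun τ _ hτ => ⟨?_, ?_, hτ.1, ?_⟩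
  · have := F.upd; have := F.lt; omega
  · intro e he τ hτ hx _ _
    have hR : Ready J τ := hR₂.of_agree hτ (by decide) (by decide) (by decide) (by decide)
    have hb' : τ 11 0 = b := by rw [hτ 11 (by decide), h₂ 11 (by decide), h₁ 11 (by decide), hb]
    have ht' : τ 22 0 = t := by rw [hτ 22 (by decide), h₂ 22 (by decide), ht₁]
    have hRe : eR.eval τ = r := by
      simp [eR, hτ 8 (by decide), h₂ 8 (by decide), h₁ 8 (by decide), hR.eval_eV, hs]
    have hk : eKey.eval τ = d := by
      simp [eKey, hR.eval_em, hRe, hb', hτ 10 (by decide), h₂ 10 (by decide), h₁ 10 (by decide), hd]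
    constructor
    · simp [ht', hx, hR.eval_em]
    · simp only [eval_sub, eval_div, eval_mul, eval_rd, eval_add, eval_var, eval_ofNat,
        hk, hx, hR.pow e he.le, hR.pow (e + 1) he, pow_succ, ← Nat.div_div_eq_div_mul]
      omega
  · rw [hτ.2 _ fun j _ => by omega, e₂.1]
  · rw [hτ.2 _ fun j _ => by omega, e₂.2.1]
  · intro a ha
    rw [hτ.2 _ fun j _ => by omega, e₂.2.2 a ha]

theorem runs_updateWeights (F : Fits J β Q) {σ : Mem} (h : Ready J σ) (hy : Weights J y σ)
    {x : ℕ → ℕ} (hx : J.Sol x) {t v : ℕ} (hv : σ 11 0 / σ 8 0 = v) (hvV : v ≤ J.V)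
    (ht : σ 22 0 = t) (hrec : ∀ e < J.m, σ 1 (3 + t * (J.m + 2) + e) = x e) :
    Runs β Q updateWeights σ fun τ => ∀ k < J.n, τ 7 k = upd (y k) v (J.val k x) := by
  refine (Runs.forLoop J.n (fun i τ => (∀ k < i, τ 7 k = upd (y k) v (J.val k x)) ∧
      ∀ k, i ≤ k → τ 7 k = σ 7 k) F.n_le F.lt (by decide)
    (fun τ hτ => (h.toHeader.of_eq (hτ 0 (by decide))).eval_en) (fun i τ v hi => ?_) (by simp)
    ?_).mono fun τ _ hτ => hτ.1
  · rwa [write_bank_ne _ _ _ (by decide)]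
  rintro k hk τ hτ hxk ⟨hI, hI'⟩
  refine (Runs.store (φ := fun τ => τ 14 0 = 0) (by simp) (by simp [write_same])).seq
    fun τ₁ h₁ e₁ => ?_
  have hR : Ready J τ := h.of_agree hτ (by decide) (by decide) (by decide) (by decide)
  have hR₁ : Ready J τ₁ := hR.of_agree h₁ (by decide) (by decide) (by decide) (by decide)
  refine (Runs.fold J.m (fun i => ∑ e ∈ range i, J.rwt k e * x e) F.m_le F.lt (by decide)
    (fun τ hτ => (hR₁.toHeader.of_eq (hτ 0 (by decide))).eval_em) (fun i hi => ?_) (by simp [e₁])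
    ?_).seq fun τ₂ h₂ e₂ => ?_
  · have h1 : ∑ e ∈ range i, J.rwt k e * x e ≤ J.m * (J.B * 1) :=
      sum_range_le_mul (fun e _ => Nat.mul_le_mul (min_le_left _ _) (hx.1 e)) hi
    have h2 : J.m * (J.B * 1) = J.V := by rw [mul_one, IntKnapsack.V]
    have := F.upd
    have := F.lt
    omega
  · intro e he ρ hρ hxe hacc
    have hRρ : Ready J ρ := hR₁.of_agree hρ (by decide) (by decide) (by decide) (by decide)
    rw [sum_range_succ]
    simp [hacc, hxe, hRρ.eval_em, hρ 21 (by decide), h₁ 21 (by decide), hxk, hRρ.rwt k hk e he,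
      hρ 22 (by decide), h₁ 22 (by decide), hτ 22 (by decide), ht,
      hρ 1 (by decide), h₁ 1 (by decide), hτ 1 (by decide), hrec e he]
  · have hx₂ : (var 21).eval τ₂ = k := by simp [h₂ 21 (by decide), h₁ 21 (by decide), hxk]
    have hy₂ : τ₂ 7 k = y k := by
      rw [h₂ 7 (by decide), h₁ 7 (by decide), hI' k le_rfl, hy.eq k hk]
    have hval : (1 + ((rd 7 (var 21) + var 11 / var 8) - (var 14 + 1))).eval τ₂ =
        upd (y k) v (J.val k x) := by
      simp only [eval_add, eval_sub, eval_rd, hx₂, hy₂, eval_div]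
      simp [h₂ 11 (by decide), h₁ 11 (by decide), hτ 11 (by decide), h₂ 8 (by decide),
        h₁ 8 (by decide), hτ 8 (by decide), hv, e₂, upd, IntKnapsack.val]
    refine .store ?_ ?_
    · rw [hval, upd]
      have := hy.le k hk
      have := F.upd
      have := F.lt
      omega
    · rw [hval, hx₂]
      refine ⟨fun k' hk' => ?_, fun k' hk' => ?_⟩
      · rcases Nat.lt_succ_iff_lt_or_eq.1 hk' with hk' | rfl
        · rw [write_index_ne _ _ _ hk'.ne, h₂ 7 (by decide), h₁ 7 (by decide), hI k' hk']
        · rw [write_same]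
      · rw [write_index_ne _ _ _ (by omega), h₂ 7 (by decide), h₁ 7 (by decide),
          hI' k' (by omega)]

end RobustKnapsackProgram

/-! ### The round invariant, preprocessing, and the whole program. -/

namespace RobustKnapsackProgram

open Ram Finset IntKnapsack

variable {β Q : ℕ} {J : IntKnapsack}

/-- The memory bank `o` holds `t` records for the sets `X 0, …, X (t - 1)`. -/
def Records (J : IntKnapsack) (t : ℕ) (X : ℕ → ℕ → ℕ) (o : ℕ → ℕ) : Prop :=
  ∀ s < t, o (1 + s * (J.m + 2)) = 1 ∧ o (2 + s * (J.m + 2)) = J.T ∧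
    ∀ e < J.m, o (3 + s * (J.m + 2) + e) = X s e

/-- The state of the memory after `t` rounds. -/
def RoundInv (J : IntKnapsack) (t : ℕ) (τ : Mem) : Prop :=
  Ready J τ ∧ ∃ y X, (∀ k < J.n, τ 7 k = y k) ∧ J.Progress t y X ∧ Records J t X (τ 1)

theorem record_lt {s t m e : ℕ} (hs : s < t) (he : e < m) :
    3 + s * (m + 2) + e < 1 + t * (m + 2) := by
  have : (s + 1) * (m + 2) ≤ t * (m + 2) := Nat.mul_le_mul_right _ hs
  rw [add_mul] at this
  omega

theorem runs_round (F : Fits J β Q) {σ : Mem} {t : ℕ} (ht : t < J.T) (hσt : σ 22 0 = t)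
    (hσ : RoundInv J t σ) : Runs β Q round σ (RoundInv J (t + 1)) := by
  obtain ⟨h, y, X, hy, hP, hrec⟩ := hσ
  have hW : Weights J y σ := ⟨fun k hk => hP.le ht.le hk, hy⟩
  have hw : width J y ≤ Q := width_le F hW.le
  obtain ⟨x, hx, hx1, hx2, hx3⟩ := exists_opt (profit J y) _ (sum_profit_lt y)
  refine (runs_totalWeight F h.toHeader hW).seq fun σ₁ h₁ e₁ => ?_
  have R₁ := h.of_agree h₁ (by decide) (by decide) (by decide) (by decide)
  refine (runs_profits F R₁ (hW.of_eq (h₁ 7 (by decide)))).seq fun σ₂ h₂ e₂ => ?_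
  have R₂ := R₁.of_agree h₂ (by decide) (by decide) (by decide) (by decide)
  have s₂ : σ₂ 8 0 = ∑ k ∈ range J.n, y k := by rw [h₂ 8 (by decide), e₁]
  refine (runs_dynamicProgram F R₂ hw (by rw [s₂, width]) e₂).seq fun σ₃ h₃ e₃ => ?_
  have R₃ := R₂.of_agree h₃ (by decide) (by decide) (by decide) (by decide)
  have s₃ : σ₃ 8 0 = ∑ k ∈ range J.n, y k := by rw [h₃ 8 (by decide), s₂]
  refine (runs_maximumProfit F R₃ hw (by rw [s₃, width]) e₃).seq fun σ₄ h₄ e₄ => ?_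
  have R₄ := R₃.of_agree h₄ (by decide) (by decide) (by decide) (by decide)
  have s₄ : σ₄ 8 0 = ∑ k ∈ range J.n, y k := by rw [h₄ 8 (by decide), s₃]
  have t₄ : σ₄ 22 0 = t := by
    rw [h₄ 22 (by decide), h₃ 22 (by decide), h₂ 22 (by decide), h₁ 22 (by decide), hσt]
  have o₄ : σ₄ 1 = σ 1 := by
    rw [h₄ 1 (by decide), h₃ 1 (by decide), h₂ 1 (by decide), h₁ 1 (by decide)]
  have y₄ : σ₄ 7 = σ 7 := by
    rw [h₄ 7 (by decide), h₃ 7 (by decide), h₂ 7 (by decide), h₁ 7 (by decide)]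
  have hbest : J.best (profit J y) (width J y) < width J y := by
    rw [← hx1]
    refine (sum_le_sum fun e _ => ?_).trans_lt (sum_profit_lt y)
    exact (Nat.mul_le_mul_left _ (hx.1 e)).trans (mul_one _).le
  refine (runs_writeRecord F R₄ (r := width J y) (by rw [s₄, width]) e₄
    (d := J.dp (profit J y) J.m (J.best (profit J y) (width J y))) (by rw [h₄ 10 (by decide), e₃ _ hbest]) t₄).seq fun σ₅ h₅ ⟨a₅, b₅, c₅, d₅⟩ => ?_
  have R₅ := R₄.of_agree h₅ (by decide) (by decide) (by decide) (by decide)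
  have c₅' : ∀ e < J.m, σ₅ 1 (3 + t * (J.m + 2) + e) = x e := fun e he => by rw [c₅ e he, hx3 e he]
  have hv : σ₅ 11 0 / σ₅ 8 0 =
      (∑ k ∈ range J.n, y k * J.val k x) / ∑ k ∈ range J.n, y k := by
    rw [h₅ 11 (by decide), h₅ 8 (by decide), e₄, s₄, ← hx1, sum_profit_mul]
  have hvV : (∑ k ∈ range J.n, y k * J.val k x) / ∑ k ∈ range J.n, y k ≤ J.V := by
    refine Nat.div_le_of_le_mul ?_
    rw [sum_mul]
    exact sum_le_sum fun k _ => Nat.mul_le_mul_left _ (val_le k hx)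
  refine (runs_updateWeights F R₅ (hW.of_eq ((h₅ 7 (by decide)).trans y₄)) hx hv hvV
    (by rw [h₅ 22 (by decide), t₄]) c₅').mono fun τ h₆ e₆ => ?_
  refine ⟨R₅.of_agree h₆ (by decide) (by decide) (by decide) (by decide), τ 7,
    Function.update X t x, fun _ _ => rfl, ?_, ?_⟩
  · have hX : ∀ s < t, Function.update X t x s = X s := fun s hs =>
      Function.update_of_ne hs.ne _ _
    -- `Progress` after `t` rounds involves only the sets with index below `t`, so the new set may
    -- be installed at index `t` beforehand.
    have hP' : J.Progress t y (Function.update X t x) := by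
      refine ⟨hP.pos, hP.sum_sq, fun s hs => by rw [hX s hs]; exact hP.sol s hs,
        fun g hg k hk => ?_⟩
      rw [sum_congr rfl fun s hs => by rw [hX s (mem_range.1 hs)]]
      exact hP.gain g hg k hk
    refine hP'.succ F.n_pos (by simpa using hx) (fun x' hx' => ?_) rfl (by simpa using e₆)
    rw [Function.update_self, ← sum_profit_mul, ← sum_profit_mul, hx1]
    exact hx2 x' hx'
  · rw [h₆ 1 (by decide)]
    intro s hs
    rcases Nat.lt_succ_iff_lt_or_eq.1 hs with hs | rfl
    · have old : ∀ a < 1 + t * (J.m + 2), σ₅ 1 a = σ 1 a := fun a ha => by rw [d₅ a ha, o₄]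
      obtain ⟨r1, r2, r3⟩ := hrec s hs
      have := record_lt hs F.m_pos
      refine ⟨?_, ?_, fun e he => ?_⟩
      · rw [old _ (by omega), r1]
      · rw [old _ (by omega), r2]
      · rw [old _ (record_lt hs he), r3 e he, Function.update_of_ne hs.ne]
    · exact ⟨a₅, b₅, fun e he => by rw [c₅' e he, Function.update_self]⟩

/-- The memory holds the input: rational numbers with the given numerators and denominators. -/
structure Input (J : IntKnapsack) (num den : ℕ → ℕ) (σ : Mem) : Prop extends Header J σ where
  num : ∀ i < 1 + J.m + J.n * J.m, σ 0 (3 + 2 * i) = num i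
  den : ∀ i < 1 + J.m + J.n * J.m, σ 0 (4 + 2 * i) = den i

theorem Input.of_eq {num den : ℕ → ℕ} {σ τ : Mem} (h : Input J num den σ) (e : τ 0 = σ 0) :
    Input J num den τ :=
  ⟨h.toHeader.of_eq e, by rw [e]; exact h.num, by rw [e]; exact h.den⟩

theorem Header.eval_entries {σ : Mem} (h : Header J σ) :
    (1 + em + en * em).eval σ = 1 + J.m + J.n * J.m := by simp [h.eval_em, h.eval_en]

theorem runs_denominator (F : Fits J β Q) {num den : ℕ → ℕ} {σ : Mem} (h : Input J num den σ)
    (hD : ∀ i ≤ 1 + J.m + J.n * J.m, ∏ j ∈ range i, den j < 2 ^ β) :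
    Runs β Q denominator σ fun τ => τ 2 0 = ∏ j ∈ range (1 + J.m + J.n * J.m), den j := by
  refine (Runs.store (φ := fun τ => τ 2 0 = 1) ?_ (by simp [write_same])).seq fun σ₁ h₁ e₁ => ?_
  · have := F.entries; have := F.lt; simp only [eval_one]; omega
  have h₁' := h.of_eq (h₁ 0 (by decide))
  refine Runs.fold _ (fun i => ∏ j ∈ range i, den j) F.entries F.lt (by decide)
    (fun τ hτ => (h₁'.toHeader.of_eq (hτ 0 (by decide))).eval_entries) hD (by simp [e₁]) ?_
  intro i hi τ hτ hx hacc
  rw [prod_range_succ]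
  simp [hacc, hx, (h₁'.of_eq (hτ 0 (by decide))).den i hi]

theorem runs_integralData (F : Fits J β Q) {num den : ℕ → ℕ} {σ : Mem} (h : Input J num den σ)
    (ha : ∀ i < 1 + J.m + J.n * J.m, J.a i = num i * (σ 2 0 / den i)) :
    Runs β Q integralData σ fun τ => ∀ i < 1 + J.m + J.n * J.m, τ 3 i = J.a i := by
  refine (Runs.fill _ (fun i => i) J.a F.entries F.lt (by decide)
    (fun τ hτ => (h.toHeader.of_eq (hτ 0 (by decide))).eval_entries) (fun i _ j hj => hj.ne)
    F.data ?_).mono fun τ _ hτ => hτ.1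
  intro i hi τ hτ hx _ _
  have hI := h.of_eq (hτ 0 (by decide))
  simp [hx, hI.num i hi, hI.den i hi, hτ 2 (by decide), ha i hi]

theorem two_pow_lt (F : Fits J β Q) {e : ℕ} (he : e ≤ J.m) : 2 ^ e < 2 ^ β := by
  refine lt_of_le_of_lt ?_ F.inf
  calc 2 ^ e ≤ 1 * 2 ^ J.m := by rw [one_mul]; exact Nat.pow_le_pow_right (by norm_num) he
    _ ≤ J.inf := Nat.mul_le_mul_right _ (Nat.succ_pos _)

theorem runs_powers (F : Fits J β Q) {σ : Mem} (h : Header J σ) :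
    Runs β Q powers σ fun τ => ∀ e ≤ J.m, τ 4 e = 2 ^ e := by
  refine (Runs.store (φ := fun τ => τ 4 0 = 1) ?_ (by simp [write_same])).seq fun σ₁ h₁ e₁ => ?_
  · have := F.entries; have := F.lt; simp only [eval_one]; omega
  refine (Runs.fill J.m (fun e => e + 1) (fun e => 2 ^ (e + 1)) F.m_le F.lt (by decide)
    (fun τ hτ => (h.of_eq ((hτ 0 (by decide)).trans (h₁ 0 (by decide)))).eval_em)
    (fun i _ j hj => by omega) (fun e he => two_pow_lt F he) ?_).mono fun τ _ hτ e he => ?_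
  · intro e he τ hτ hx hnew hold
    have : τ 4 e = 2 ^ e := by
      cases e with
      | zero => rw [hold 0 (by simp), e₁, pow_zero]
      | succ e => exact hnew e (by omega)
    simp [hx, this, pow_succ, mul_comm]
  · cases e with
    | zero => rw [hτ.2 0 (by simp), e₁, pow_zero]
    | succ e => exact hτ.1 e he

theorem top_lt (F : Fits J β Q) {k e : ℕ} (hk : k < J.n) (he : e ≤ J.m) : J.top k e < 2 ^ β := by
  induction e with
  | zero => simp [top]
  | succ e ih =>
    rw [top]
    refine max_lt (ih (by omega)) (lt_of_le_of_lt ?_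
      (F.data (1 + J.m + (k * J.m + e)) (by have := index_lt hk he; omega)))
    exact (Nat.mul_le_mul_left _ (Nat.sub_le _ _)).trans (mul_one _).le

theorem low_succ_le (k : ℕ) : J.low (k + 1) ≤ J.top k J.m := by
  rw [low]
  rcases Nat.eq_zero_or_pos (J.low k) with h | h
  · simp [h]
  · rw [Nat.sub_eq_zero_of_le h, zero_mul, add_zero]
    exact min_le_right _ _

theorem runs_magnitude (F : Fits J β Q) {σ : Mem} (h : Header J σ)
    (ha : ∀ i < 1 + J.m + J.n * J.m, σ 3 i = J.a i) :
    Runs β Q magnitude σ fun τ => τ 5 0 = J.L := by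
  refine (Runs.store (φ := fun τ => τ 5 0 = 0) (by simp) (by simp [write_same])).seq
    fun σ₁ h₁ e₁ => ?_
  have h₁' := h.of_eq (h₁ 0 (by decide))
  refine Runs.forLoop J.n (fun k τ => τ 5 0 = J.low k) F.n_le F.lt (by decide)
    (fun τ hτ => (h₁'.of_eq (hτ 0 (by decide))).eval_en) (fun i τ v hi => ?_) e₁ ?_
  · rwa [write_bank_ne _ _ _ (by decide)]
  intro k hk τ hτ hx hI
  refine (Runs.store (φ := fun τ => τ 15 0 = 0) (by simp) (by simp [write_same])).seq
    fun τ₁ g₁ e₂ => ?_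
  have hH : Header J τ₁ := h₁'.of_eq ((g₁ 0 (by decide)).trans (hτ 0 (by decide)))
  refine (Runs.fold J.m (J.top k) F.m_le F.lt (by decide)
    (fun τ hτ => (hH.of_eq (hτ 0 (by decide))).eval_em) (fun e he => top_lt F hk he) e₂
    ?_).seq fun τ₂ g₂ e₃ => ?_
  · intro e he ρ hρ hxe hacc
    have h3 : ρ 3 = σ 3 := by
      rw [hρ 3 (by decide), g₁ 3 (by decide), hτ 3 (by decide), h₁ 3 (by decide)]
    have := index_lt hk he
    simp only [eval_eMax, eval_mul, eval_rd, eval_var, eval_add, eval_sub, eval_one,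
      (hH.of_eq (hρ 0 (by decide))).eval_em, hρ 21 (by decide), g₁ 21 (by decide), hx, hxe, hacc,
      h3, eval_zero, top, wt, IntKnapsack.sz, IntKnapsack.cap]
    rw [ha _ (by omega), ha _ (by omega), ha _ (by omega)]
  · have hv : (eMin (var 5) (var 15) + (1 - var 5) * var 15).eval τ₂ = J.low (k + 1) := by
      simp [e₃, g₂ 5 (by decide), g₁ 5 (by decide), hI, low]
    refine .store ?_ ?_
    · rw [hv]
      exact (low_succ_le k).trans_lt (top_lt F hk le_rfl)
    · rw [hv, eval_zero, write_same]

theorem runs_roundedWeights (F : Fits J β Q) {σ : Mem} (h : Header J σ)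
    (ha : ∀ i < 1 + J.m + J.n * J.m, σ 3 i = J.a i) (hL : σ 5 0 = J.L) :
    Runs β Q roundedWeights σ fun τ => ∀ k < J.n, ∀ e < J.m, τ 6 (k * J.m + e) = J.rwt k e := by
  refine (Runs.fill (J.n * J.m) (fun i => i) (fun i => min J.B (J.a (1 + J.m + i) * J.K / J.L))
    ?_ F.lt (by decide) (fun τ hτ => ?_) (fun i _ j hj => hj.ne) (fun i _ => ?_) ?_).mono
    fun τ _ hτ k hk e he => hτ.1 _ (index_lt hk he)
  · have := F.entries; omega
  · have := h.of_eq (hτ 0 (by decide))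
    simp [this.eval_en, this.eval_em]
  · exact (min_le_left _ _).trans_lt (F.B.trans_lt F.lt)
  · intro i hi τ hτ hx _ _
    have := h.of_eq (hτ 0 (by decide))
    simp [hx, this.eval_eB, this.eval_eK, this.eval_em, hτ 3 (by decide), hτ 5 (by decide), hL,
      ha (1 + J.m + i) (by omega)]

theorem runs_initialWeights (F : Fits J β Q) {σ : Mem} (h : Header J σ) :
    Runs β Q initialWeights σ fun τ => ∀ k < J.n, τ 7 k = 1 := by
  refine (Runs.fill J.n (fun i => i) (fun _ => 1) F.n_le F.lt (by decide)
    (fun τ hτ => (h.of_eq (hτ 0 (by decide))).eval_en) (fun i _ j hj => hj.ne)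
    (fun i _ => ?_) ?_).mono fun τ _ hτ => hτ.1
  · have := F.entries; have := F.lt; omega
  · intro i hi τ hτ hx _ _
    simp [hx]

/-- The program computes a list of solutions, the average of which is good in every scenario. -/
theorem runs_program (F : Fits J β Q) {num den : ℕ → ℕ} {σ : Mem} (h : Input J num den σ)
    (hD : ∀ i ≤ 1 + J.m + J.n * J.m, ∏ j ∈ range i, den j < 2 ^ β)
    (ha : ∀ i < 1 + J.m + J.n * J.m,
      J.a i = num i * ((∏ j ∈ range (1 + J.m + J.n * J.m), den j) / den i)) :
    Runs β Q program σ fun τ => τ 1 0 = J.T ∧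
      ∃ y X, J.Progress J.T y X ∧ Records J J.T X (τ 1) := by
  refine (runs_denominator F h hD).seq fun σ₁ h₁ e₁ => ?_
  have I₁ := h.of_eq (h₁ 0 (by decide))
  refine (runs_integralData F I₁ (by simpa [e₁] using ha)).seq fun σ₂ h₂ e₂ => ?_
  have H₂ := I₁.toHeader.of_eq (h₂ 0 (by decide))
  refine (runs_powers F H₂).seq fun σ₃ h₃ e₃ => ?_
  have H₃ := H₂.of_eq (h₃ 0 (by decide))
  have a₃ : ∀ i < 1 + J.m + J.n * J.m, σ₃ 3 i = J.a i := by rwa [h₃ 3 (by decide)]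
  refine (runs_magnitude F H₃ a₃).seq fun σ₄ h₄ e₄ => ?_
  have H₄ := H₃.of_eq (h₄ 0 (by decide))
  have a₄ : ∀ i < 1 + J.m + J.n * J.m, σ₄ 3 i = J.a i := by rwa [h₄ 3 (by decide)]
  refine (runs_roundedWeights F H₄ a₄ e₄).seq fun σ₅ h₅ e₅ => ?_
  have H₅ := H₄.of_eq (h₅ 0 (by decide))
  refine (runs_initialWeights F H₅).seq fun σ₆ h₆ e₆ => ?_
  have a₆ : ∀ i < 1 + J.m + J.n * J.m, σ₆ 3 i = J.a i := by
    rwa [h₆ 3 (by decide), h₅ 3 (by decide)]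
  have R₆ : Ready J σ₆ := by
    refine ⟨H₅.of_eq (h₆ 0 (by decide)), a₆ _ (by omega), fun e he => a₆ _ (by omega), ?_, ?_⟩
    · rwa [h₆ 4 (by decide), h₅ 4 (by decide), h₄ 4 (by decide)]
    · rwa [h₆ 6 (by decide)]
  have hT : J.T < 2 ^ β := by have := F.upd; have := F.lt; omega
  refine (Runs.forLoop J.T (RoundInv J) (by have := F.upd; omega) F.lt (by decide)
    (fun τ hτ => (R₆.toHeader.of_eq (hτ 0 (by decide))).eval_eT) (fun i τ v hi => ?_) ?_
    (fun t ht τ _ hx hI => runs_round F ht hx hI)).seq fun σ₇ h₇ ⟨R₇, y, X, _, hP, hrec⟩ => ?_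
  · obtain ⟨hR, y, X, h1, h2, h3⟩ := hi
    refine ⟨hR.of_agree (l := [22]) (fun b hb => write_bank_ne _ _ _ (by simpa using hb))
      (by decide) (by decide) (by decide) (by decide), y, X, ?_, h2, ?_⟩
    · rwa [write_bank_ne _ _ _ (by decide)]
    · rwa [write_bank_ne _ _ _ (by decide)]
  · exact ⟨R₆, fun _ => 1, 0, e₆, .zero _, fun s hs => absurd hs (Nat.not_lt_zero s)⟩
  -- The records begin in cell `1`, so writing the record count into cell `0` at the end does not
  -- disturb them.
  · refine .store (by rwa [R₇.eval_eT]) ?_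
    rw [R₇.eval_eT, eval_zero]
    refine ⟨write_same _ _ _ _, y, X, hP, fun s hs => ?_⟩
    obtain ⟨r1, r2, r3⟩ := hrec s hs
    refine ⟨?_, ?_, fun e he => ?_⟩
    · rw [write_index_ne _ _ _ (by omega), r1]
    · rw [write_index_ne _ _ _ (by omega), r2]
    · rw [write_index_ne _ _ _ (by omega), r3 e he]

end RobustKnapsackProgram

/-! ### The approximation guarantee: losses from rounding, truncation and play. -/

namespace IntKnapsack

open Finset

variable {J : IntKnapsack}

theorem le_top {k e i : ℕ} (he : e < i) (hs : J.sz e ≤ J.cap) :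
    J.wt k e ≤ J.top k i := by
  induction i with
  | zero => omega
  | succ i ih =>
    rw [top]
    rcases Nat.lt_succ_iff_lt_or_eq.1 he with h | rfl
    · exact (ih h).trans (le_max_left _ _)
    · refine le_trans ?_ (le_max_right _ _)
      rw [Nat.sub_eq_zero_of_le hs, Nat.sub_zero, mul_one]

theorem exists_eq_top (k : ℕ) {i : ℕ} (h : 0 < J.top k i) :
    ∃ e < i, J.sz e ≤ J.cap ∧ J.wt k e = J.top k i := by
  induction i with
  | zero => simp [top] at h
  | succ i ih =>
    rw [top] at h ⊢
    rcases max_choice (J.top k i) (J.wt k i * (1 - (J.sz i - J.cap))) with h' | h' <;>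
      rw [h'] at h ⊢
    · obtain ⟨e, h1, h2, h3⟩ := ih h
      exact ⟨e, by omega, h2, h3⟩
    · have hs : J.sz i ≤ J.cap := by
        by_contra! hs
        rw [show 1 - (J.sz i - J.cap) = 0 by omega] at h
        simp at h
      exact ⟨i, by omega, hs, by simp [Nat.sub_eq_zero_of_le hs]⟩

theorem low_spec (hpos : ∀ k < J.n, 0 < J.top k J.m) {i : ℕ} (hi : 0 < i) (hn : i ≤ J.n) :
    (∃ k < i, J.low i = J.top k J.m) ∧ ∀ k < i, J.low i ≤ J.top k J.m := by
  induction i, hi using Nat.le_induction with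
  | base => simp [low]
  | succ i hi ih =>
    obtain ⟨⟨k₀, hk₀, e₀⟩, hle⟩ := ih (by omega)
    have hl : 1 - J.low i = 0 := by
      have := hpos k₀ (by omega)
      omega
    rw [low, hl, zero_mul, add_zero]
    constructor
    · rcases min_choice (J.low i) (J.top i J.m) with h | h <;> rw [h]
      · exact ⟨k₀, by omega, e₀⟩
      · exact ⟨i, by omega, rfl⟩
    · intro k hk
      rcases Nat.lt_succ_iff_lt_or_eq.1 hk with hk | rfl
      · exact (min_le_left _ _).trans (hle k hk)
      · exact min_le_right _ _

/-- The parameters are positive, and in each scenario some item that fits into the knapsack has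
positive weight. -/
structure Nondegenerate (J : IntKnapsack) : Prop where
  N_pos : 0 < J.N
  n_pos : 0 < J.n
  m_pos : 0 < J.m
  item : ∀ k < J.n, ∃ e < J.m, J.sz e ≤ J.cap ∧ 0 < J.wt k e

theorem Nondegenerate.top_pos (h : J.Nondegenerate) : ∀ k < J.n, 0 < J.top k J.m := fun k hk => by
  obtain ⟨e, he, hs, hw⟩ := h.item k hk
  exact hw.trans_le (le_top he hs)

theorem Nondegenerate.L_pos (h : J.Nondegenerate) : 0 < J.L := by
  obtain ⟨⟨k, hk, e⟩, -⟩ := low_spec h.top_pos h.n_pos le_rfl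
  rw [L, e]
  exact h.top_pos k hk

theorem Nondegenerate.exists_L_le (h : J.Nondegenerate) {k : ℕ} (hk : k < J.n) :
    ∃ e < J.m, J.sz e ≤ J.cap ∧ J.L ≤ J.wt k e := by
  obtain ⟨e, h1, h2, h3⟩ := exists_eq_top k (h.top_pos k hk)
  exact ⟨e, h1, h2, h3 ▸ (low_spec h.top_pos h.n_pos le_rfl).2 k hk⟩

theorem Nondegenerate.exists_le_L (h : J.Nondegenerate) :
    ∃ k < J.n, ∀ e < J.m, J.sz e ≤ J.cap → J.wt k e ≤ J.L := by
  obtain ⟨⟨k, hk, e⟩, -⟩ := low_spec h.top_pos h.n_pos le_rfl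
  refine ⟨k, hk, fun i hi hs => ?_⟩
  rw [L, e]
  exact le_top hi hs

/-- The indicator of a set of items. -/
def ind (X : Finset (Fin J.m)) (e : ℕ) : ℕ := if ∃ h : e < J.m, ⟨e, h⟩ ∈ X then 1 else 0

theorem ind_le (X : Finset (Fin J.m)) (e : ℕ) : ind X e ≤ 1 := by
  unfold ind; split <;> omega

theorem sum_mul_ind (g : ℕ → ℕ) (X : Finset (Fin J.m)) :
    ∑ e ∈ range J.m, g e * ind X e = ∑ e ∈ X, g e := by
  rw [Finset.sum_range]
  simp [ind]

variable (J) in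
/-- The family of sets that fit into the knapsack. -/
def feas : Finset (Finset (Fin J.m)) := univ.filter fun X => ∑ e ∈ X, J.sz e ≤ J.cap

theorem sol_ind {X : Finset (Fin J.m)} (hX : X ∈ J.feas) : J.Sol (ind X) := by
  refine ⟨ind_le X, ?_⟩
  rw [sum_mul_ind]
  simpa [feas] using hX

theorem val_ind (k : ℕ) (X : Finset (Fin J.m)) : J.val k (ind X) = ∑ e ∈ X, J.rwt k e :=
  sum_mul_ind _ X

theorem sz_le_of_mem_feas {X : Finset (Fin J.m)} (hX : X ∈ J.feas) {e : Fin J.m} (he : e ∈ X) :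
    J.sz e ≤ J.cap := by
  have h : ∑ e ∈ X, J.sz e ≤ J.cap := by simpa [feas] using hX
  exact (single_le_sum (f := fun e : Fin J.m => J.sz e) (fun _ _ => Nat.zero_le _) he).trans h

/-- The bound `μ` is met by playing `q` with probability `1 - θ` and otherwise one of the `m` items
at random, an item that does not fit counting as the empty set. For fixed scenario weights the best
set is at least as good as this mixture; the value attained is an integer comparison, hence the
floor. -/
theorem attainable_of_mix (hm : 0 < J.m) {q : Finset (Fin J.m) → ℝ} (hq0 : ∀ X, 0 ≤ q X)
    (hq1 : ∑ X ∈ J.feas, q X = 1) {θ μ : ℝ} (h0 : 0 ≤ θ) (h1 : θ ≤ 1)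
    (h : ∀ k < J.n, μ ≤ (1 - θ) * ∑ X ∈ J.feas, q X * (J.val k (ind X) : ℝ) +
      θ / J.m * ∑ e ∈ univ.filter fun e : Fin J.m => J.sz e ≤ J.cap, (J.rwt k e : ℝ)) :
    J.Attainable ⌊μ⌋₊ := by
  intro y
  have hne : J.feas.Nonempty := ⟨∅, by simp [feas]⟩
  obtain ⟨X₀, hX₀, hmax⟩ := exists_max_image J.feas
    (fun X => ∑ k ∈ range J.n, y k * J.val k (ind X)) hne
  refine ⟨ind X₀, sol_ind hX₀, ?_⟩
  set b : ℕ := ∑ k ∈ range J.n, y k * J.val k (ind X₀) with hb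
  have hmaxR : ∀ X ∈ J.feas, ∑ k ∈ range J.n, (y k : ℝ) * (J.val k (ind X) : ℝ) ≤ b := by
    intro X hX
    exact_mod_cast hmax X hX
  rcases le_total μ 0 with hμ | hμ
  · simp [Nat.floor_of_nonpos hμ]
  have hmR : (0 : ℝ) < J.m := by exact_mod_cast hm
  have e1 : ∑ k ∈ range J.n, (y k : ℝ) * ∑ X ∈ J.feas, q X * (J.val k (ind X) : ℝ) ≤ b := by
    calc ∑ k ∈ range J.n, (y k : ℝ) * ∑ X ∈ J.feas, q X * (J.val k (ind X) : ℝ)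
        = ∑ X ∈ J.feas, q X * ∑ k ∈ range J.n, (y k : ℝ) * (J.val k (ind X) : ℝ) := by
          simp only [mul_sum]
          rw [sum_comm]
          exact sum_congr rfl fun _ _ => sum_congr rfl fun _ _ => by ring
      _ ≤ ∑ X ∈ J.feas, q X * b :=
          sum_le_sum fun X hX => mul_le_mul_of_nonneg_left (hmaxR X hX) (hq0 X)
      _ = b := by rw [← sum_mul, hq1, one_mul]
  have e2 : ∑ k ∈ range J.n, (y k : ℝ) *
      ∑ e ∈ univ.filter fun e : Fin J.m => J.sz e ≤ J.cap, (J.rwt k e : ℝ) ≤ J.m * b := by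
    calc _ = ∑ e ∈ univ.filter fun e : Fin J.m => J.sz e ≤ J.cap,
          ∑ k ∈ range J.n, (y k : ℝ) * (J.rwt k e : ℝ) := by
          simp only [mul_sum]
          rw [sum_comm]
      _ ≤ ∑ e ∈ univ.filter fun e : Fin J.m => J.sz e ≤ J.cap, (b : ℝ) := by
          refine sum_le_sum fun e he => ?_
          -- A fitting item is itself a solution, so its weighted value is at most that of the best
          -- response.
          have := hmaxR {e} (by simpa [feas] using he)
          simpa [val_ind] using this
      _ ≤ ∑ e : Fin J.m, (b : ℝ) :=
          sum_le_sum_of_subset_of_nonneg (subset_univ _) fun _ _ _ => by positivity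
      _ = J.m * b := by simp
  have e3 : μ * ∑ k ∈ range J.n, (y k : ℝ) ≤ b := by
    calc μ * ∑ k ∈ range J.n, (y k : ℝ) = ∑ k ∈ range J.n, (y k : ℝ) * μ := by
          rw [mul_comm, sum_mul]
      _ ≤ ∑ k ∈ range J.n, (y k : ℝ) * ((1 - θ) * ∑ X ∈ J.feas, q X * (J.val k (ind X) : ℝ) +
          θ / J.m * ∑ e ∈ univ.filter fun e : Fin J.m => J.sz e ≤ J.cap, (J.rwt k e : ℝ)) :=
          sum_le_sum fun k hk => mul_le_mul_of_nonneg_left (h k (mem_range.1 hk)) (by positivity)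
      _ = (1 - θ) * (∑ k ∈ range J.n, (y k : ℝ) * ∑ X ∈ J.feas, q X * (J.val k (ind X) : ℝ)) +
          θ / J.m * ∑ k ∈ range J.n, (y k : ℝ) *
            ∑ e ∈ univ.filter fun e : Fin J.m => J.sz e ≤ J.cap, (J.rwt k e : ℝ) := by
          rw [mul_sum (s := range J.n), mul_sum (s := range J.n), ← sum_add_distrib]
          exact sum_congr rfl fun _ _ => by ring
      _ ≤ (1 - θ) * b + θ / J.m * (J.m * b) :=
          add_le_add (mul_le_mul_of_nonneg_left e1 (by linarith))
            (mul_le_mul_of_nonneg_left e2 (by positivity))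
      _ = b := by field_simp; ring
  have e4 : ((⌊μ⌋₊ * ∑ k ∈ range J.n, y k : ℕ) : ℝ) ≤ b := by
    push_cast
    refine le_trans ?_ e3
    exact mul_le_mul_of_nonneg_right (Nat.floor_le hμ) (by positivity)
  exact_mod_cast e4

/-- An average of the chosen sets is good when all rounds were good. -/
theorem le_average (hJ : J.Nondegenerate) {y : ℕ → ℕ} {X : ℕ → ℕ → ℕ}
    (hP : J.Progress J.T y X) {μ : ℝ} (hμ : J.Attainable ⌊μ⌋₊) {k : ℕ} (hk : k < J.n) :
    J.L / J.K * (μ - 2) ≤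
      (∑ s ∈ range J.T, ∑ e ∈ range J.m, (J.wt k e : ℝ) * X s e) / J.T := by
  have hm := hJ.m_pos
  have hn := hJ.n_pos
  have hN := hJ.N_pos
  have hT : 0 < J.T := by unfold T; positivity
  have hTR : (0 : ℝ) < J.T := by exact_mod_cast hT
  have hLR : (0 : ℝ) < J.L := by exact_mod_cast hJ.L_pos
  have hKR : (0 : ℝ) < J.K := by
    have : 0 < J.K := by unfold K; positivity
    exact_mod_cast this
  -- The `2` in the conclusion consists of one unit for the final weight `y k ≤ T`, averaged over
  -- `T` rounds, and one for the floor of `μ`.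
  have h1 : (J.T : ℝ) * ⌊μ⌋₊ ≤ J.T + ∑ s ∈ range J.T, (J.val k (X s) : ℝ) := by
    have h2 := hP.gain _ hμ k hk
    have h3 := hP.le le_rfl hk
    exact_mod_cast h2.trans (Nat.add_le_add_right h3 _)
  have h2 : ∀ s, (J.val k (X s) : ℝ) ≤
      J.K / J.L * ∑ e ∈ range J.m, (J.wt k e : ℝ) * X s e := fun s => by
    rw [val, mul_sum]
    push_cast
    refine sum_le_sum fun e _ => ?_
    rw [← mul_assoc]
    refine mul_le_mul_of_nonneg_right ?_ (by positivity)
    calc ((J.rwt k e : ℕ) : ℝ) ≤ ((J.wt k e * J.K / J.L : ℕ) : ℝ) := by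
          exact_mod_cast min_le_right _ _
      _ ≤ ((J.wt k e * J.K : ℕ) : ℝ) / J.L := Nat.cast_div_le
      _ = J.K / J.L * J.wt k e := by push_cast; ring
  have h3 : (J.T : ℝ) * (μ - 2) ≤
      J.K / J.L * ∑ s ∈ range J.T, ∑ e ∈ range J.m, (J.wt k e : ℝ) * X s e := by
    have h4 := sum_le_sum (s := range J.T) fun s _ => h2 s
    rw [← mul_sum] at h4
    have h5 := Nat.lt_floor_add_one μ
    nlinarith
  rw [le_div_iff₀ hTR]
  calc (J.L : ℝ) / J.K * (μ - 2) * J.T = J.L / J.K * (J.T * (μ - 2)) := by ring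
    _ ≤ J.L / J.K * (J.K / J.L * ∑ s ∈ range J.T, ∑ e ∈ range J.m, (J.wt k e : ℝ) * X s e) :=
        mul_le_mul_of_nonneg_left h3 (by positivity)
    _ = _ := by field_simp

/-- The case `θ = 1` of the mixture: every scenario has a fitting item of weight at least `L`, whose
rounded weight is at least `K` and which is drawn with probability `1 / m`. -/
theorem attainable_uniform (hJ : J.Nondegenerate) {q : Finset (Fin J.m) → ℝ} (hq0 : ∀ X, 0 ≤ q X)
    (hq1 : ∑ X ∈ J.feas, q X = 1) : J.Attainable ⌊(J.K : ℝ) / J.m⌋₊ := by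
  refine attainable_of_mix hJ.m_pos hq0 hq1 zero_le_one le_rfl fun k hk => ?_
  obtain ⟨e, he, hs, hw⟩ := hJ.exists_L_le hk
  have h1 : J.K ≤ J.rwt k e := by
    refine le_min ?_ ?_
    · rw [B]
      calc J.K = 1 * J.K * 1 := by ring
        _ ≤ 2 * J.N * J.K * (J.m * J.m) := by
          gcongr
          · have := hJ.N_pos; omega
          · exact Nat.mul_pos hJ.m_pos hJ.m_pos
    · rw [Nat.le_div_iff_mul_le (hJ.L_pos), mul_comm]
      exact Nat.mul_le_mul_right _ hw
  have h2 : (J.K : ℝ) ≤ ∑ e ∈ univ.filter fun e : Fin J.m => J.sz e ≤ J.cap, (J.rwt k e : ℝ) := by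
    refine le_trans (by exact_mod_cast h1) (single_le_sum (s := univ.filter fun e : Fin J.m =>
      J.sz e ≤ J.cap) (f := fun e : Fin J.m => (J.rwt k e : ℝ)) (fun _ _ => by positivity)
      (a := ⟨e, he⟩) (by simpa using hs))
  rw [sub_self, zero_mul, zero_add, one_div, div_eq_inv_mul]
  exact mul_le_mul_of_nonneg_left h2 (by positivity)

/-- In the scenario that defines `L`, no item of a solution weighs more than `L`. -/
theorem le_mul_L (hJ : J.Nondegenerate) {q : Finset (Fin J.m) → ℝ} (hq0 : ∀ X, 0 ≤ q X)
    (hq1 : ∑ X ∈ J.feas, q X = 1) {l : ℝ}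
    (hl : ∀ k < J.n, l ≤ ∑ X ∈ J.feas, q X * ∑ e ∈ X, (J.wt k e : ℝ)) : l ≤ J.m * J.L := by
  obtain ⟨k, hk, hle⟩ := hJ.exists_le_L
  calc l ≤ ∑ X ∈ J.feas, q X * ∑ e ∈ X, (J.wt k e : ℝ) := hl k hk
    _ ≤ ∑ X ∈ J.feas, q X * (J.m * J.L) := by
        refine sum_le_sum fun X hX => mul_le_mul_of_nonneg_left ?_ (hq0 X)
        calc ∑ e ∈ X, (J.wt k e : ℝ) ≤ ∑ e ∈ X, (J.L : ℝ) :=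
              sum_le_sum fun e he => by
                exact_mod_cast hle e e.2 (sz_le_of_mem_feas hX he)
          _ ≤ ∑ e : Fin J.m, (J.L : ℝ) :=
              sum_le_sum_of_subset_of_nonneg (subset_univ _) fun _ _ _ => by positivity
          _ = J.m * J.L := by simp
    _ = J.m * J.L := by rw [← sum_mul, hq1, one_mul]

/-- Mixing uses `θ = 1 / (2 * N)`. A scenario with a fitting item that reaches the cap `B` is
satisfied by the random single item alone; in every other scenario no solution is affected by
truncation and rounding costs at most one unit per item. -/
theorem attainable_of_strategy (hJ : J.Nondegenerate) {q : Finset (Fin J.m) → ℝ}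
    (hq0 : ∀ X, 0 ≤ q X) (hq1 : ∑ X ∈ J.feas, q X = 1) {l : ℝ} (hl0 : 0 ≤ l)
    (hl : ∀ k < J.n, l ≤ ∑ X ∈ J.feas, q X * ∑ e ∈ X, (J.wt k e : ℝ)) :
    J.Attainable ⌊(1 - 1 / (2 * J.N)) * (J.K / J.L * l) - J.m⌋₊ := by
  have hNR : (1 : ℝ) ≤ J.N := by exact_mod_cast hJ.N_pos
  have hmR : (1 : ℝ) ≤ J.m := by exact_mod_cast hJ.m_pos
  have hLR : (0 : ℝ) < J.L := by exact_mod_cast hJ.L_pos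
  have hθ0 : (0 : ℝ) ≤ 1 / (2 * J.N) := by positivity
  have hθ1 : 1 / (2 * (J.N : ℝ)) ≤ 1 := by
    rw [div_le_one (by positivity)]
    linarith
  refine attainable_of_mix hJ.m_pos hq0 hq1 hθ0 hθ1 fun k hk => ?_
  by_cases hcap : ∃ e : Fin J.m, J.sz e ≤ J.cap ∧ J.B ≤ J.wt k e * J.K / J.L
  · obtain ⟨e, hs, hB⟩ := hcap
    have h1 : (J.B : ℝ) ≤
        ∑ e ∈ univ.filter fun e : Fin J.m => J.sz e ≤ J.cap, (J.rwt k e : ℝ) := by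
      refine le_trans ?_ (single_le_sum (s := univ.filter fun e : Fin J.m =>
        J.sz e ≤ J.cap) (f := fun e : Fin J.m => (J.rwt k e : ℝ)) (fun _ _ => by positivity)
        (a := e) (by simpa using hs))
      rw [rwt, min_eq_left hB]
    have h2 : (J.K : ℝ) / J.L * l ≤ J.K * J.m := by
      have := le_mul_L hJ hq0 hq1 hl
      calc (J.K : ℝ) / J.L * l ≤ J.K / J.L * (J.m * J.L) :=
            mul_le_mul_of_nonneg_left this (by positivity)
        _ = J.K * J.m := by field_simp
    -- `B` is chosen for this identity: a capped item, drawn with probability `θ / m`, contributes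
    -- the scaled upper bound `K * m` for the optimum.
    have h3 : 1 / (2 * (J.N : ℝ)) / J.m * J.B = J.K * J.m := by
      rw [B]
      push_cast
      field_simp
    have h4 : 0 ≤ (1 - 1 / (2 * (J.N : ℝ))) *
        ∑ X ∈ J.feas, q X * (J.val k (ind X) : ℝ) :=
      mul_nonneg (by linarith) (sum_nonneg fun X _ => mul_nonneg (hq0 X) (by positivity))
    have h5 := mul_le_mul_of_nonneg_left h1 (show 0 ≤ 1 / (2 * (J.N : ℝ)) / J.m by positivity)
    have h6 : 0 ≤ 1 / (2 * (J.N : ℝ)) * (J.K / J.L * l) := by positivity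
    rw [sub_mul, one_mul]
    linarith
  · push Not at hcap
    have h1 : ∀ X ∈ J.feas, J.K / J.L * (∑ e ∈ X, (J.wt k e : ℝ)) - J.m ≤ J.val k (ind X) := by
      intro X hX
      rw [val_ind, mul_sum]
      have h2 : ∀ e ∈ X, J.K / J.L * (J.wt k e : ℝ) ≤ (J.rwt k e : ℝ) + 1 := by
        intro e he
        rw [rwt, min_eq_right (hcap e (sz_le_of_mem_feas hX he)).le]
        have := Nat.lt_div_mul_add (a := J.wt k e * J.K) (hJ.L_pos)
        rw [div_mul_eq_mul_div, div_le_iff₀ hLR]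
        have h3 : ((J.wt k e * J.K : ℕ) : ℝ) ≤
            ((J.wt k e * J.K / J.L * J.L + J.L : ℕ) : ℝ) := by exact_mod_cast this.le
        push_cast at h3 ⊢
        linarith
      have h3 := sum_le_sum h2
      have h4 : ∑ e ∈ X, ((J.rwt k e : ℝ) + 1) ≤ ∑ e ∈ X, (J.rwt k e : ℝ) + J.m := by
        rw [sum_add_distrib]
        have : X.card ≤ J.m := by simpa using card_le_univ X
        simpa using this
      push_cast
      linarith
    have h2 : J.K / J.L * l - J.m ≤ ∑ X ∈ J.feas, q X * (J.val k (ind X) : ℝ) := by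
      have h3 : ∑ X ∈ J.feas, q X * (J.K / J.L * (∑ e ∈ X, (J.wt k e : ℝ)) - J.m) ≤
          ∑ X ∈ J.feas, q X * (J.val k (ind X) : ℝ) :=
        sum_le_sum fun X hX => mul_le_mul_of_nonneg_left (h1 X hX) (hq0 X)
      have h4 : ∑ X ∈ J.feas, q X * (J.K / J.L * (∑ e ∈ X, (J.wt k e : ℝ)) - J.m) =
          J.K / J.L * (∑ X ∈ J.feas, q X * ∑ e ∈ X, (J.wt k e : ℝ)) - J.m := by
        simp only [mul_sub, sum_sub_distrib, ← sum_mul, hq1, one_mul]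
        rw [mul_sum]
        congr 1
        exact sum_congr rfl fun _ _ => by ring
      have h5 := mul_le_mul_of_nonneg_left (hl k hk) (show (0 : ℝ) ≤ J.K / J.L by positivity)
      linarith
    have h6 : 0 ≤ 1 / (2 * (J.N : ℝ)) / J.m *
        ∑ e ∈ univ.filter fun e : Fin J.m => J.sz e ≤ J.cap, (J.rwt k e : ℝ) := by positivity
    have h7 := mul_le_mul_of_nonneg_left h2 (show 0 ≤ 1 - 1 / (2 * (J.N : ℝ)) by linarith)
    have h8 : 0 ≤ 1 / (2 * (J.N : ℝ)) * J.m := by positivity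
    nlinarith

/-- Additive losses are relative to `L / m`. If `l` is at least that large they are absorbed into
`l`; otherwise the uniform single item, which guarantees about `L / m`, already suffices. -/
theorem Nondegenerate.approx (hJ : J.Nondegenerate) {q : Finset (Fin J.m) → ℝ} (hq0 : ∀ X, 0 ≤ q X)
    (hq1 : ∑ X ∈ J.feas, q X = 1) {l : ℝ} (hl0 : 0 ≤ l)
    (hl : ∀ k < J.n, l ≤ ∑ X ∈ J.feas, q X * ∑ e ∈ X, (J.wt k e : ℝ))
    {y : ℕ → ℕ} {X : ℕ → ℕ → ℕ} (hP : J.Progress J.T y X) {k : ℕ} (hk : k < J.n) :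
    (1 - 1 / J.N) * l ≤
      (∑ s ∈ range J.T, ∑ e ∈ range J.m, (J.wt k e : ℝ) * X s e) / J.T := by
  have hNR : (1 : ℝ) ≤ J.N := by exact_mod_cast hJ.N_pos
  have hmR : (1 : ℝ) ≤ J.m := by exact_mod_cast hJ.m_pos
  have hLR : (0 : ℝ) < J.L := by exact_mod_cast hJ.L_pos
  have hK : (J.K : ℝ) = 2 * J.N * J.m * (J.m + 2) := by rw [K]; push_cast; ring
  rcases le_total ((J.L : ℝ) / J.m) l with h | h
  · refine le_trans ?_ (le_average hJ hP
      (attainable_of_strategy hJ hq0 hq1 hl0 hl) hk)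
    -- `K` is chosen so that the additive loss `m + 2`, namely `m` for rounding and `2` for the
    -- play, becomes `L / m / (2 * N)` after rescaling. The other half of `1 / N` was spent on
    -- mixing.
    have e : (J.L : ℝ) / J.K * ((1 - 1 / (2 * J.N)) * (J.K / J.L * l) - J.m - 2) =
        (1 - 1 / (2 * J.N)) * l - J.L / J.m / (2 * J.N) := by
      rw [hK]
      field_simp
      ring
    rw [e]
    have h2 : (J.L : ℝ) / J.m / (2 * J.N) ≤ l / (2 * J.N) := by gcongr
    have h3 : (1 - 1 / (2 * (J.N : ℝ))) * l - l / (2 * J.N) = (1 - 1 / J.N) * l := by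
      field_simp
      ring
    linarith
  · refine le_trans ?_ (le_average hJ hP (attainable_uniform hJ hq0 hq1) hk)
    have h1 : (0 : ℝ) ≤ 1 - 1 / J.N := by
      rw [sub_nonneg, div_le_one (by positivity)]
      exact hNR
    refine (mul_le_mul_of_nonneg_left h h1).trans ?_
    have e : (J.L : ℝ) / J.K * (J.K / J.m - 2) = J.L / J.m - J.L / J.m / J.N * (1 / (J.m + 2)) := by
      rw [hK]
      field_simp
    rw [e, sub_mul, one_mul]
    have h2 : (J.L : ℝ) / J.m / J.N * (1 / (J.m + 2)) ≤ J.L / J.m / J.N * 1 := by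
      gcongr
      rw [div_le_one (by positivity)]
      linarith
    have h3 : 1 / (J.N : ℝ) * (J.L / J.m) = J.L / J.m / J.N := by ring
    linarith

end IntKnapsack

/-! ### Rational instances: encoding, common denominator, and size bounds. -/

namespace RobustKnapsack

open Ram Finset

variable (I : RobustKnapsack)

/-- The rational numbers of an instance, in the order of the input. -/
def rats : List NNRat :=
  I.C :: (List.ofFn I.s ++ (List.ofFn fun k => List.ofFn (I.w k)).flatten)

/-- The rational number number `i` of the input. -/
def entry (i : ℕ) : NNRat := I.rats.getD i 0

theorem encode_eq : I.encode = I.n :: I.m :: I.rats.flatMap encodeRat := by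
  have h : (List.ofFn fun k => (List.ofFn (I.w k)).flatMap encodeRat).flatten =
      (List.ofFn fun k => List.ofFn (I.w k)).flatten.flatMap encodeRat := by
    rw [List.flatMap_def, List.map_flatten, List.flatten_flatten, List.map_map, List.map_ofFn]
    rfl
  simp [encode, rats, h, List.flatMap_append]

theorem flatten_eq : (List.ofFn fun k => List.ofFn (I.w k)).flatten =
    List.ofFn fun i : Fin (I.n * I.m) => I.w i.divNat i.modNat := by
  rw [List.ofFn_mul]
  congr 2
  funext k
  congr 1
  funext e
  have hk : (k * I.m + e : ℕ) / I.m = k := by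
    rw [mul_comm, Nat.mul_add_div (by have := e.2; omega), Nat.div_eq_of_lt e.2, add_zero]
  have he : (k * I.m + e : ℕ) % I.m = e := by
    rw [mul_comm, Nat.mul_add_mod, Nat.mod_eq_of_lt e.2]
  congr 1 <;> ext <;> simp [Fin.divNat, Fin.modNat, hk, he]

theorem length_rats : I.rats.length = 1 + I.m + I.n * I.m := by
  simp [rats, flatten_eq]
  omega

theorem entry_zero : I.entry 0 = I.C := rfl

theorem entry_size (e : Fin I.m) : I.entry (1 + e) = I.s e := by
  rw [entry, rats, add_comm, List.getD_cons_succ, List.getD_append _ _ _ _ (by simp),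
    List.getD_eq_getElem _ _ (by simp)]
  simp

theorem entry_weight (k : Fin I.n) (e : Fin I.m) :
    I.entry (1 + I.m + (k * I.m + e)) = I.w k e := by
  have hlt := RobustKnapsackProgram.index_lt k.2 e.2
  have hk : (k * I.m + e : ℕ) / I.m = k := by
    rw [mul_comm, Nat.mul_add_div (by have := e.2; omega), Nat.div_eq_of_lt e.2, add_zero]
  have he : (k * I.m + e : ℕ) % I.m = e := by
    rw [mul_comm, Nat.mul_add_mod, Nat.mod_eq_of_lt e.2]
  rw [entry, rats, show 1 + I.m + (k * I.m + e) = (I.m + (k * I.m + e)) + 1 by ring,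
    List.getD_cons_succ, List.getD_append_right _ _ _ _ (by simp), flatten_eq,
    List.getD_eq_getElem _ _ (by simpa using hlt), List.getElem_ofFn]
  congr 1 <;> ext <;> simp [Fin.divNat, Fin.modNat, hk, he]

theorem getD_flatMap_encodeRat (l : List NNRat) (i : ℕ) (hi : i < l.length) :
    (l.flatMap encodeRat).getD (2 * i) 0 = (l.getD i 0).num ∧
      (l.flatMap encodeRat).getD (2 * i + 1) 0 = (l.getD i 0).den := by
  induction l generalizing i with
  | nil => simp at hi
  | cons a l ih =>
    cases i with
    | zero => simp [encodeRat]
    | succ i =>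
      have := ih i (by simpa using hi)
      simpa [encodeRat, mul_add, add_assoc] using this

theorem bitSize_cons (x : ℕ) (l : List ℕ) : bitSize (x :: l) = Nat.size x + 1 + bitSize l := by
  simp [bitSize]

theorem bitSize_encodeRat (a : NNRat) (l : List NNRat) :
    bitSize ((a :: l).flatMap encodeRat) =
      Nat.size a.num + 1 + (Nat.size a.den + 1) + bitSize (l.flatMap encodeRat) := by
  simp [encodeRat, bitSize_cons]
  ring

theorem length_le_bitSize (l : List NNRat) : l.length ≤ bitSize (l.flatMap encodeRat) := by
  induction l with
  | nil => simp
  | cons a l ih =>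
    rw [bitSize_encodeRat, List.length_cons]
    omega

/-- Bit lengths add up under multiplication, so a common denominator has no more bits than the whole
input. Positions beyond the list hold `0`, whose denominator is `1`. -/
theorem prod_den_le (l : List NNRat) (i : ℕ) :
    ∏ j ∈ range i, (l.getD j 0).den ≤ 2 ^ bitSize (l.flatMap encodeRat) := by
  induction l generalizing i with
  | nil => simp [Nat.one_le_two_pow]
  | cons a l ih =>
    cases i with
    | zero => simp [Nat.one_le_two_pow]
    | succ i =>
      rw [prod_range_succ', bitSize_encodeRat]
      simp only [List.getD_cons_succ, List.getD_cons_zero]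
      calc (∏ j ∈ range i, (l.getD j 0).den) * a.den
          ≤ 2 ^ bitSize (l.flatMap encodeRat) * 2 ^ Nat.size a.den :=
            Nat.mul_le_mul (ih i) (Nat.lt_size_self _).le
        _ = 2 ^ (bitSize (l.flatMap encodeRat) + Nat.size a.den) := by rw [pow_add]
        _ ≤ _ := Nat.pow_le_pow_right (by norm_num) (by omega)

theorem getD_lt (l : List ℕ) (i : ℕ) : l.getD i 0 < 2 ^ bitSize l := by
  induction l generalizing i with
  | nil => simp
  | cons a l ih =>
    rw [bitSize_cons]
    cases i with
    | zero =>
      exact (Nat.lt_size_self a).trans_le (Nat.pow_le_pow_right (by norm_num) (by omega))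
    | succ i => exact (ih i).trans_le (Nat.pow_le_pow_right (by norm_num) (by omega))

theorem bitSize_rats_le : bitSize (I.rats.flatMap encodeRat) ≤ I.size := by
  rw [size, encode_eq, bitSize_cons, bitSize_cons]
  omega

theorem entries_le_size : 1 + I.m + I.n * I.m ≤ I.size := by
  rw [← length_rats]
  exact (length_le_bitSize _).trans I.bitSize_rats_le

/-- A common denominator of the rational numbers of an instance. -/
def denom : ℕ := ∏ j ∈ range (1 + I.m + I.n * I.m), (I.entry j).den

theorem denom_pos : 0 < I.denom := prod_pos fun j _ => (I.entry j).den_pos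

theorem denom_le : I.denom ≤ 2 ^ I.size :=
  (prod_den_le _ _).trans (Nat.pow_le_pow_right (by norm_num) I.bitSize_rats_le)

/-- The integral instance obtained by multiplication by the common denominator. -/
def toInt (N : ℕ) : IntKnapsack where
  n := I.n
  m := I.m
  N := N
  a i := (I.entry i).num * (I.denom / (I.entry i).den)

theorem cast_toInt_a (N : ℕ) {i : ℕ} (hi : i < 1 + I.m + I.n * I.m) :
    (((I.toInt N).a i : ℕ) : ℝ) = I.denom * (I.entry i : ℝ) := by
  have hd : (I.entry i).den ∣ I.denom :=
    dvd_prod_of_mem (fun j => (I.entry j).den) (mem_range.2 hi)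
  have h0 : ((I.entry i).den : ℝ) ≠ 0 := by exact_mod_cast (I.entry i).den_pos.ne'
  rw [toInt, NNRat.cast_def]
  push_cast [Nat.cast_div hd h0]
  ring

theorem cast_cap (N : ℕ) : ((I.toInt N).cap : ℝ) = I.denom * (I.C : ℝ) := by
  rw [IntKnapsack.cap, I.cast_toInt_a N (by omega), entry_zero]

theorem cast_sz (N : ℕ) (e : Fin I.m) : ((I.toInt N).sz e : ℝ) = I.denom * (I.s e : ℝ) := by
  rw [IntKnapsack.sz, I.cast_toInt_a N (by omega), entry_size]

theorem cast_wt (N : ℕ) (k : Fin I.n) (e : Fin I.m) :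
    ((I.toInt N).wt k e : ℝ) = I.denom * (I.w k e : ℝ) := by
  have := RobustKnapsackProgram.index_lt k.2 e.2
  rw [IntKnapsack.wt, show (I.toInt N).m = I.m from rfl, I.cast_toInt_a N (by omega), entry_weight]

theorem toInt_a_lt (N i : ℕ) : (I.toInt N).a i < 2 ^ (2 * I.size) := by
  have h1 : (I.entry i).num < 2 ^ I.size := by
    by_cases hi : i < I.rats.length
    · rw [entry, ← (getD_flatMap_encodeRat _ i hi).1]
      exact (getD_lt _ _).trans_le (Nat.pow_le_pow_right (by norm_num) I.bitSize_rats_le)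
    · rw [entry, List.getD_eq_default _ _ (by omega)]
      simp
  calc (I.toInt N).a i ≤ (I.entry i).num * I.denom := Nat.mul_le_mul_left _ (Nat.div_le_self _ _)
    _ ≤ (I.entry i).num * 2 ^ I.size := Nat.mul_le_mul_left _ I.denom_le
    _ < 2 ^ I.size * 2 ^ I.size := Nat.mul_lt_mul_of_pos_right h1 (by positivity)
    _ = _ := by rw [← pow_add]; congr 1; ring

theorem mem_feasible_iff (N : ℕ) (X : Finset (Fin I.m)) :
    X ∈ I.feasible ↔ ∑ e ∈ X, (I.toInt N).sz e ≤ (I.toInt N).cap := by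
  have hD : (0 : ℝ) < I.denom := by exact_mod_cast I.denom_pos
  rw [feasible, mem_filter, and_iff_right (mem_univ X), ← NNRat.cast_le (K := ℝ),
    ← Nat.cast_le (α := ℝ)]
  push_cast
  simp only [cast_sz, cast_cap, ← mul_sum]
  exact (mul_le_mul_iff_right₀ hD).symm

theorem feas_toInt (N : ℕ) : (I.toInt N).feas = I.feasible := by
  ext X
  exact (mem_filter.trans (and_iff_right (mem_univ _))).trans (I.mem_feasible_iff N X).symm

theorem cast_f (N : ℕ) (k : Fin I.n) (X : Finset (Fin I.m)) :
    ∑ e ∈ X, ((I.toInt N).wt k e : ℝ) = I.denom * I.f k X := by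
  rw [f, mul_sum]
  exact sum_congr rfl fun e _ => I.cast_wt N k e

theorem m_pos (h : ∀ k : Fin I.n, ∃ X ∈ I.feasible, 0 < I.f k X) : 0 < I.m := by
  obtain ⟨X, -, hX⟩ := h ⟨0, I.n_pos⟩
  by_contra hm
  have : X = ∅ := by
    ext e
    exact absurd e.2 (by omega)
  simp [this, f] at hX

theorem nondegenerate {N : ℕ} (hN : 0 < N) (h : ∀ k : Fin I.n, ∃ X ∈ I.feasible, 0 < I.f k X) :
    (I.toInt N).Nondegenerate where
  N_pos := hN
  n_pos := I.n_pos
  m_pos := I.m_pos h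
  item k hk := by
    obtain ⟨X, hX, hf⟩ := h ⟨k, hk⟩
    obtain ⟨e, he, hw⟩ := exists_lt_of_sum_lt (s := X) (f := fun _ => (0 : ℝ))
      (g := fun e => (I.w ⟨k, hk⟩ e : ℝ)) (by simpa [f] using hf)
    refine ⟨e, e.2, IntKnapsack.sz_le_of_mem_feas (by rwa [feas_toInt]) he, ?_⟩
    have h1 := I.cast_wt N ⟨k, hk⟩ e
    have h2 : (0 : ℝ) < I.denom := by exact_mod_cast I.denom_pos
    have h3 : (0 : ℝ) < (I.toInt N).wt k e := by rw [h1]; exact mul_pos h2 hw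
    exact_mod_cast h3

theorem input (N : ℕ) : RobustKnapsackProgram.Input (I.toInt N) (fun i => (I.entry i).num)
    (fun i => (I.entry i).den) (initMem (N :: I.encode)) := by
  have h : ∀ i, initMem (N :: I.encode) 0 (i + 3) = (I.rats.flatMap encodeRat).getD i 0 := by
    intro i
    simp [initMem, encode_eq]
  refine ⟨⟨?_, ?_, ?_⟩, fun i hi => ?_, fun i hi => ?_⟩
  · simp [initMem, toInt]
  · simp [initMem, encode_eq, toInt]
  · simp [initMem, encode_eq, toInt]
  · rw [add_comm, h]
    exact (getD_flatMap_encodeRat _ i (by rw [length_rats]; exact hi)).1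
  · rw [show 4 + 2 * i = (2 * i + 1) + 3 by ring, h]
    exact (getD_flatMap_encodeRat _ i (by rw [length_rats]; exact hi)).2

/-- With `Z = size + N` every parameter is a monomial in quantities of at most `Z`. The largest loop
count, the width of the table, is at most `Z ^ 31 + 1`. Cells hold loop-sized numbers or keys and
input data of linear bit length, so `32 * Z` bits suffice, as `Z < 2 ^ Z`. -/
theorem fits {N : ℕ} (hN : 0 < N) (h : ∀ k : Fin I.n, ∃ X ∈ I.feasible, 0 < I.f k X) :
    RobustKnapsackProgram.Fits (I.toInt N) (32 * (I.size + N)) ((I.size + N) ^ 32) := by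
  have hm := I.m_pos h
  have hn := I.n_pos
  have hs := I.entries_le_size
  have hnm : I.n ≤ I.n * I.m := Nat.le_mul_of_pos_right _ hm
  set Z := I.size + N with hZ
  have hZ4 : 4 ≤ Z := by
    have : 0 < I.n * I.m := Nat.mul_pos hn hm
    omega
  have hZ1 : ∀ i j, i ≤ j → Z ^ i ≤ Z ^ j := fun i j hij => Nat.pow_le_pow_right (by omega) hij
  have hK : (I.toInt N).K ≤ Z ^ 4 := by
    calc 2 * N * I.m * (I.m + 2) ≤ Z * Z * Z * Z := by gcongr <;> omega
      _ = Z ^ 4 := by ring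
  have hB : (I.toInt N).B ≤ Z ^ 8 := by
    calc 2 * N * (I.toInt N).K * (I.m * I.m) ≤ Z * Z * Z ^ 4 * (Z * Z) := by gcongr <;> omega
      _ = Z ^ 8 := by ring
  have hV : (I.toInt N).V ≤ Z ^ 9 := by
    calc I.m * (I.toInt N).B ≤ Z * Z ^ 8 := by gcongr; omega
      _ = Z ^ 9 := by ring
  have hT : (I.toInt N).T ≤ Z ^ 21 := by
    have h1 : Z ^ 9 * Z ^ 9 + 1 ≤ Z ^ 19 := by
      have : Z ^ 19 = Z * Z ^ 18 := by ring
      have h4 : 4 * Z ^ 18 ≤ Z * Z ^ 18 := Nat.mul_le_mul_right _ hZ4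
      have : 0 < Z ^ 18 := by positivity
      rw [show Z ^ 9 * Z ^ 9 = Z ^ 18 by ring]
      omega
    calc 2 * I.n * ((I.toInt N).V * (I.toInt N).V + 1) ≤ Z * Z * (Z ^ 9 * Z ^ 9 + 1) := by
          gcongr <;> omega
      _ ≤ Z * Z * Z ^ 19 := Nat.mul_le_mul_left _ h1
      _ = Z ^ 21 := by ring
  have hnT : I.n * (I.toInt N).T ≤ Z ^ 22 := by
    calc I.n * (I.toInt N).T ≤ Z * Z ^ 21 := by gcongr; omega
      _ = Z ^ 22 := by ring
  have h31 : 4 * Z ^ 31 ≤ Z ^ 32 := by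
    rw [pow_succ Z 31, mul_comm]
    exact Nat.mul_le_mul_left _ hZ4
  have p31 : 0 < Z ^ 31 := by positivity
  have hz := hZ1 1 32 (by norm_num)
  have h8 := hZ1 8 32 (by norm_num)
  have h9 := hZ1 9 31 (by norm_num)
  have h21 := hZ1 21 31 (by norm_num)
  have h22 := hZ1 22 32 (by norm_num)
  rw [pow_one] at hz
  refine ⟨hn, hm, ?_, ?_, ?_, hnT.trans h22, ?_, hB.trans h8, ?_, fun i _ => ?_⟩
  · rw [mul_comm, pow_mul]
    exact Nat.pow_lt_pow_left Nat.lt_two_pow_self (by norm_num)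
  · exact hs.trans (by omega)
  · have : I.n * (I.toInt N).T * (I.toInt N).V ≤ Z ^ 31 := by
      calc I.n * (I.toInt N).T * (I.toInt N).V ≤ Z ^ 22 * Z ^ 9 := Nat.mul_le_mul hnT hV
        _ = Z ^ 31 := by ring
    exact (Nat.succ_le_succ this).trans (by omega)
  · omega
  · calc ((I.toInt N).cap + 1) * 2 ^ I.m ≤ 2 ^ (2 * I.size) * 2 ^ I.m :=
          Nat.mul_le_mul_right _ (I.toInt_a_lt N 0)
      _ = 2 ^ (2 * I.size + I.m) := by rw [pow_add]
      _ < 2 ^ (32 * Z) := Nat.pow_lt_pow_right (by norm_num) (by omega)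
  · exact (I.toInt_a_lt N i).trans_le (Nat.pow_le_pow_right (by norm_num) (by omega))

theorem bounded_initMem (N : ℕ) : Bounded (32 * (I.size + N)) (initMem (N :: I.encode)) := by
  intro b i
  unfold initMem
  split
  · cases i with
    | zero =>
      rw [List.getD_cons_zero]
      exact Nat.lt_two_pow_self.trans_le (Nat.pow_le_pow_right (by norm_num) (by omega))
    | succ i =>
      exact (getD_lt I.encode i).trans_le
        (Nat.pow_le_pow_right (by norm_num) (by rw [← size]; omega))
  · positivity

theorem value_nonneg {q : Finset (Fin I.m) → ℝ} (hq : I.IsStrategy q) : 0 ≤ I.value q :=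
  Real.iInf_nonneg fun k => sum_nonneg fun X _ => mul_nonneg (hq.1 X)
    (sum_nonneg fun e _ => by positivity)

theorem value_le (q : Finset (Fin I.m) → ℝ) (k : Fin I.n) :
    I.value q ≤ ∑ X ∈ I.feasible, q X * I.f k X :=
  ciInf_le (Set.finite_range _).bddBelow k

/-! ### Reading the output as a strategy, and the final bounds. -/

section

variable {I} {N : ℕ} {o : ℕ → ℕ} {X : ℕ → ℕ → ℕ} {T : ℕ}

theorem sum_outSet {t : ℕ} (ho : ∀ e < I.m, o (3 + t * (I.m + 2) + e) = X t e)
    (hX : ∀ e, X t e ≤ 1) {R : Type*} [Semiring R] (g : ℕ → R) :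
    ∑ e ∈ I.outSet o t, g e = ∑ e ∈ range I.m, g e * X t e := by
  rw [Finset.sum_range, outSet, sum_filter]
  refine sum_congr rfl fun e _ => ?_
  rw [ho e e.2]
  rcases Nat.le_one_iff_eq_zero_or_eq_one.1 (hX e) with h | h <;> simp [h]

theorem decode_eq (h0 : o 0 = T) (h1 : ∀ s < T, o (1 + s * (I.m + 2)) = 1)
    (h2 : ∀ s < T, o (2 + s * (I.m + 2)) = T) (Y : Finset (Fin I.m)) :
    I.decode o Y = ∑ t ∈ range T, if I.outSet o t = Y then 1 / (T : ℝ) else 0 := by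
  rw [decode, h0]
  refine sum_congr rfl fun t ht => ?_
  rw [h1 t (mem_range.1 ht), h2 t (mem_range.1 ht), Nat.cast_one]

theorem isStrategy_decode (hT : 0 < T) (h0 : o 0 = T) (h1 : ∀ s < T, o (1 + s * (I.m + 2)) = 1)
    (h2 : ∀ s < T, o (2 + s * (I.m + 2)) = T) (h3 : ∀ s < T, I.outSet o s ∈ I.feasible) :
    I.IsStrategy (I.decode o) := by
  have hTR : (T : ℝ) ≠ 0 := by exact_mod_cast hT.ne'
  refine ⟨fun Y => ?_, fun Y hY => ?_, ?_⟩
  · rw [decode_eq h0 h1 h2]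
    exact sum_nonneg fun t _ => by split <;> positivity
  · rw [decode_eq h0 h1 h2]
    refine sum_eq_zero fun t ht => if_neg fun h => hY ?_
    rw [← h]
    exact h3 t (mem_range.1 ht)
  · simp only [decode_eq h0 h1 h2]
    rw [sum_comm, sum_congr rfl fun t ht => by
      rw [sum_ite_eq, if_pos (h3 t (mem_range.1 ht))]]
    simp [hTR]

/-- A set may occur in several records; exchanging the sums makes an expectation under the decoded
strategy the plain average over the records. -/
theorem sum_decode (h0 : o 0 = T) (h1 : ∀ s < T, o (1 + s * (I.m + 2)) = 1)
    (h2 : ∀ s < T, o (2 + s * (I.m + 2)) = T) (h3 : ∀ s < T, I.outSet o s ∈ I.feasible)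
    (g : Finset (Fin I.m) → ℝ) :
    ∑ Y ∈ I.feasible, I.decode o Y * g Y = (∑ t ∈ range T, g (I.outSet o t)) / T := by
  simp only [decode_eq h0 h1 h2, sum_mul, ite_mul, zero_mul]
  rw [sum_comm, sum_div]
  refine sum_congr rfl fun t ht => ?_
  rw [sum_ite_eq, if_pos (h3 t (mem_range.1 ht))]
  ring

end

/-- The output of the program is a strategy that is almost as good as every other strategy. -/
theorem isStrategy_and_value_le {N : ℕ} (hN : 0 < N)
    (h : ∀ k : Fin I.n, ∃ X ∈ I.feasible, 0 < I.f k X) {o : ℕ → ℕ}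
    {y : ℕ → ℕ} {X : ℕ → ℕ → ℕ} (h0 : o 0 = (I.toInt N).T)
    (hP : (I.toInt N).Progress (I.toInt N).T y X)
    (hR : RobustKnapsackProgram.Records (I.toInt N) (I.toInt N).T X o) :
    I.IsStrategy (I.decode o) ∧ ∀ q : Finset (Fin I.m) → ℝ, I.IsStrategy q →
      (1 - 1 / N) * I.value q ≤ I.value (I.decode o) := by
  have hJ := I.nondegenerate hN h
  have hT : 0 < (I.toInt N).T := Nat.mul_pos (Nat.mul_pos two_pos I.n_pos) (Nat.succ_pos _)
  have h1 : ∀ s < (I.toInt N).T, o (1 + s * (I.m + 2)) = 1 := fun s hs => (hR s hs).1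
  have h2 : ∀ s < (I.toInt N).T, o (2 + s * (I.m + 2)) = (I.toInt N).T := fun s hs => (hR s hs).2.1
  have h3 : ∀ s < (I.toInt N).T, I.outSet o s ∈ I.feasible := fun s hs => by
    rw [mem_feasible_iff I N, sum_outSet (hR s hs).2.2 (hP.sol s hs).1]
    exact (hP.sol s hs).2
  refine ⟨isStrategy_decode hT h0 h1 h2 h3, fun q hq => ?_⟩
  have hD : (0 : ℝ) < I.denom := by exact_mod_cast I.denom_pos
  have : Nonempty (Fin I.n) := ⟨⟨0, I.n_pos⟩⟩
  refine le_ciInf fun k => ?_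
  have key := hJ.approx (q := q) hq.1 (by rw [feas_toInt]; exact hq.2.2)
    (mul_nonneg hD.le (I.value_nonneg hq)) (fun k hk => ?_) hP k.2
  · rw [sum_decode h0 h1 h2 h3]
    have hsum : ∑ s ∈ range (I.toInt N).T, ∑ e ∈ range (I.toInt N).m,
        ((I.toInt N).wt k e : ℝ) * X s e =
        I.denom * ∑ s ∈ range (I.toInt N).T, I.f k (I.outSet o s) := by
      rw [mul_sum]
      refine sum_congr rfl fun s hs => ?_
      rw [← I.cast_f N k]
      exact (sum_outSet (hR s (mem_range.1 hs)).2.2 (hP.sol s (mem_range.1 hs)).1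
        (fun e => ((I.toInt N).wt k e : ℝ))).symm
    -- Both sides carry the common denominator as a positive factor, which cancels.
    rw [hsum, mul_div_assoc, mul_left_comm] at key
    exact le_of_mul_le_mul_left key hD
  · have hv := mul_le_mul_of_nonneg_left (I.value_le q ⟨k, hk⟩) hD.le
    rw [feas_toInt]
    refine hv.trans (le_of_eq ?_)
    rw [mul_sum]
    refine sum_congr rfl fun Y _ => ?_
    rw [mul_left_comm, ← I.cast_f N ⟨k, hk⟩ Y]
    rfl

/-- The program halts in polynomial time with a good strategy. -/
theorem exists_exec : ∃ c d : ℕ, ∀ I : RobustKnapsack,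
    (∀ k : Fin I.n, ∃ X ∈ I.feasible, 0 < I.f k X) → ∀ N : ℕ, 0 < N → ∃ (t : ℕ) (τ : Mem),
      Exec RobustKnapsackProgram.program (initMem (N :: I.encode)) t τ ∧
      t ≤ c * (I.size + N) ^ d ∧ I.IsStrategy (I.decode (τ 1)) ∧
      ∀ q : Finset (Fin I.m) → ℝ, I.IsStrategy q →
        (1 - 1 / N) * I.value q ≤ I.value (I.decode (τ 1)) := by
  obtain ⟨C, hC⟩ := RobustKnapsackProgram.program.bound_le
  refine ⟨C * 33, 1 + 33 * RobustKnapsackProgram.program.depth, fun I h N hN => ?_⟩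
  have F := I.fits hN h
  have hden : ∀ i ≤ 1 + I.m + I.n * I.m,
      ∏ j ∈ range i, (I.entry j).den < 2 ^ (32 * (I.size + N)) := fun i _ =>
    (prod_den_le _ i).trans_lt (Nat.pow_lt_pow_right (by norm_num)
      (by have := I.bitSize_rats_le; omega))
  obtain ⟨t, τ, h1, h2, -, -, h3, y, X, h4, h5⟩ := RobustKnapsackProgram.runs_program F
    (I.input N) hden (fun i _ => rfl) (I.bounded_initMem N)
  refine ⟨t, τ, h1, (h2.trans (hC _ _)).trans ?_, I.isStrategy_and_value_le hN h h3 h4 h5⟩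
  set Z := I.size + N with hZ
  have hZ2 : 2 ≤ Z := by have := I.entries_le_size; omega
  have hQ : Z ^ 32 + 1 ≤ Z ^ 33 := by
    have h6 : 2 * Z ^ 32 ≤ Z * Z ^ 32 := Nat.mul_le_mul_right _ hZ2
    have h7 : 0 < Z ^ 32 := by positivity
    rw [pow_succ Z 32, mul_comm]
    omega
  calc C * (32 * Z + 1) * (Z ^ 32 + 1) ^ RobustKnapsackProgram.program.depth
      ≤ C * (33 * Z) * (Z ^ 33) ^ RobustKnapsackProgram.program.depth := by gcongr; omega
    _ = _ := by rw [← pow_mul, pow_add, pow_one]; ring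

end RobustKnapsack

/-- There is an FPTAS: one program which, given an instance `I` and the accuracy `⌈1/ε⌉`
(in bank `0`), halts after a run of cost polynomial in the bit size of `I` and in `1/ε`, leaving in
bank `1` an explicit randomized strategy whose worst case value is at least `1 - ε` times the
worst case value of every randomized strategy. -/
theorem theorem4p9 :
    ∃ (P : Ram.Prog) (c d : ℕ), ∀ I : RobustKnapsack,
      (∀ k : Fin I.n, ∃ X ∈ I.feasible, 0 < I.f k X) →
      ∀ ε : ℝ, 0 < ε →
        ∃ (t : ℕ) (τ : Ram.Mem),
          Ram.Exec P (Ram.initMem (⌈1 / ε⌉₊ :: I.encode)) t τ ∧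
          (t : ℝ) ≤ c * ((I.size : ℝ) + 1 / ε) ^ d ∧
          I.IsStrategy (I.decode (τ 1)) ∧
          ∀ q : Finset (Fin I.m) → ℝ, I.IsStrategy q →
            (1 - ε) * I.value q ≤ I.value (I.decode (τ 1)) := by
  obtain ⟨c, d, H⟩ := RobustKnapsack.exists_exec
  refine ⟨RobustKnapsackProgram.program, c * 2 ^ d, d, fun I hI ε hε => ?_⟩
  have hN : 0 < ⌈1 / ε⌉₊ := Nat.ceil_pos.2 (by positivity)
  obtain ⟨t, τ, h1, h2, h3, h4⟩ := H I hI _ hN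
  refine ⟨t, τ, h1, ?_, h3, fun q hq => (mul_le_mul_of_nonneg_right ?_ (I.value_nonneg hq)).trans
    (h4 q hq)⟩
  · have hs : (1 : ℝ) ≤ I.size := by
      have := I.entries_le_size
      exact_mod_cast (show 1 ≤ I.size by omega)
    have hc := Nat.ceil_lt_add_one (show 0 ≤ 1 / ε by positivity)
    have hpos : 0 < 1 / ε := by positivity
    calc (t : ℝ) ≤ c * ((I.size : ℝ) + ⌈1 / ε⌉₊) ^ d := by exact_mod_cast h2
      -- The ceiling exceeds `1 / ε` by less than `1`, and this excess is absorbed by `I.size ≥ 1`;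
      -- the factor `2` accounts for the `2 ^ d` in the constant.
      _ ≤ c * (2 * ((I.size : ℝ) + 1 / ε)) ^ d := by gcongr; linarith
      _ = ((c * 2 ^ d : ℕ) : ℝ) * ((I.size : ℝ) + 1 / ε) ^ d := by
        rw [mul_pow]
        push_cast
        ring
  · have hc := Nat.le_ceil (1 / ε)
    have hNR : (0 : ℝ) < ⌈1 / ε⌉₊ := by exact_mod_cast hN
    have : 1 / (⌈1 / ε⌉₊ : ℝ) ≤ ε := by
      rw [div_le_iff₀ hNR]
      rw [div_le_iff₀ hε] at hc
      linarith
    linarith
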